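/- Let $v_1,\dots,v_n\in\mathbb{R}^d$ be positively spanning vectors, and for $h\in\mathbb{R}^n$ put $P(h)=\{x\in\mathbb{R}^d : \langle x,v_i\rangle\le h_i \text{ for } 1\le i\le n\}$. Let $\operatorname{clir}(V)\subseteq\mathbb{R}^n$ be the closure of the set of all $h$ such that $P(h)\ne\emptyset$ and removing any one of the $n$ inequalities changes $P(h)$. Let $h_P(u)=\max_{x\in P}\langle u,x\rangle$ denote the support function of a non-empty polytope $P$. The normal fan of a non-empty polyhedron $P$ is the collection of the cones $N_F(P)=\{x : \langle x,p\rangle=\max_{z\in P}\langle x,z\rangle\ \text{for all } p\in F\}$, where $F$ runs over the non-empty faces of $P$. A simplicial polytopal fan with rays $V$ is the normal fan $\Delta$ of a non-empty polyhedron, such that every cone of $\Delta$ is generated by linearly independent vectors and the one-dimensional cones of $\Delta$ are exactly the $n$ distinct rays $\mathbb{R}_{\ge0}v_1,\dots,\mathbb{R}_{\ge0}v_n$. Its deformation cone $\mathcal{P}(\Delta)\subseteq\mathbb{R}^n$ is the closure of the set of the vectors $(h_P(v_1),\dots,h_P(v_n))$, where $P$ runs over the non-empty polytopes with normal fan $\Delta$.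 Then for all data $u^{(1)},\dots,u^{(m)}\in\mathbb{R}^d$ and $y\in\mathbb{R}^m$ the least-squares estimator $$\operatorname*{argmin}_{h\in\operatorname{clir}(V)}\ \frac1m\sum_{i=1}^m\bigl(h_{P(h)}(u^{(i)})-y^{(i)}\bigr)^2$$ is given by a piecewise quadratic program whose regions are the deformation cones of the simplicial polytopal fans with rays $V$. That is: 1. The cones $\mathcal{P}(\Delta)$, where $\Delta$ runs over the simplicial polytopal fans with rays $V$, form a polyhedral subdivision of $\operatorname{clir}(V)$: they are finitely many $n$-dimensional polyhedral cones, their union is $\operatorname{clir}(V)$, and any two of them intersect in a common face. On each of these cones the objective function agrees with a polynomial in $h$ of degree at most $2$. 2. For each such $\Delta$ there is a matrix $A^\Delta_U\in\mathbb{R}^{m\times n}$, not depending on $y$, such that $(h_{P(h)}(u^{(i)}))_{i=1}^m=A^\Delta_U h$ for all $h\in\mathcal{P}(\Delta)$. Hence the objective function equals $\frac1m\|A^\Delta_U h-y\|^2$ on $\mathcal{P}(\Delta)$, and the set of minimizers over $\operatorname{clir}(V)$ consists of all $h$ that lie in some $\mathcal{P}(\Delta)$ and satisfy $\frac1m\|A^\Delta_U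 h-y\|^2\le\frac1m\|A^{\Delta'}_U h'-y\|^2$ for all such $\Delta'$ and all $h'\in\mathcal{P}(\Delta')$. -/

import Mathlib

open scoped RealInnerProductSpace

noncomputable section

/-- The cone `pos(w)` of all nonnegative linear combinations of a finite family of vectors. -/
def posHull {E ι : Type*} [AddCommGroup E] [Module ℝ E] [Fintype ι] (w : ι → E) : Set E :=
  {x | ∃ c : ι → ℝ, (∀ i, 0 ≤ c i) ∧ x = ∑ i, c i • w i}

/-- The vectors `v` positively span the ambient space. -/
def PositivelySpanning {E ι : Type*} [AddCommGroup E] [Module ℝ E] [Fintype ι]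
    (v : ι → E) : Prop :=
  posHull v = Set.univ

/-- A polyhedron: the intersection of finitely many closed affine halfspaces. -/
def IsPolyhedron {E : Type*} [AddCommGroup E] [Module ℝ E] (P : Set E) : Prop :=
  ∃ (k : ℕ) (a : Fin k → Module.Dual ℝ E) (b : Fin k → ℝ), P = {x | ∀ j, a j x ≤ b j}

/-- A polyhedral cone: the intersection of finitely many closed linear halfspaces. -/
def IsPolyhedralCone {E : Type*} [AddCommGroup E] [Module ℝ E] (C : Set E) : Prop :=
  ∃ (k : ℕ) (a : Fin k → Module.Dual ℝ E), C = {x | ∀ j, a j x ≤ 0}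

/-- A simplicial cone: a cone generated by finitely many linearly independent vectors. -/
def IsSimplicialCone {E : Type*} [AddCommGroup E] [Module ℝ E] (σ : Set E) : Prop :=
  ∃ (k : ℕ) (w : Fin k → E), LinearIndependent ℝ w ∧ σ = posHull w

section Euclidean

variable {d n m : ℕ}

/-- A polytope: a bounded polyhedron. -/
def IsPolytope (P : Set (EuclideanSpace ℝ (Fin d))) : Prop :=
  IsPolyhedron P ∧ Bornology.IsBounded P

/-- The support function `h_P(u) = max_{y ∈ P} ⟨u, y⟩`. It is only used for nonempty
polytopes, where the supremum is finite and attained. -/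
def supportFun (P : Set (EuclideanSpace ℝ (Fin d))) (u : EuclideanSpace ℝ (Fin d)) : ℝ :=
  sSup ((fun y => ⟪u, y⟫) '' P)

/-- The normal cone of `P` at `F`: all `x` such that every point of `F` maximizes
`⟨x, ·⟩` over `P`. -/
def normalCone (P F : Set (EuclideanSpace ℝ (Fin d))) : Set (EuclideanSpace ℝ (Fin d)) :=
  {x | ∀ p ∈ F, ∀ y ∈ P, ⟪x, y⟫ ≤ ⟪x, p⟫}

/-- The normal fan of `P`: the normal cones at all nonempty faces of `P`. A nonempty face
is the set of points of `P` at which some linear functional attains its maximum on `P`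
(the zero functional gives `P` itself). -/
def normalFan (P : Set (EuclideanSpace ℝ (Fin d))) : Set (Set (EuclideanSpace ℝ (Fin d))) :=
  {N | ∃ F : Set (EuclideanSpace ℝ (Fin d)),
    F.Nonempty ∧ IsExposed ℝ P F ∧ N = normalCone P F}

/-- A fan is polytopal if it is the normal fan of a (nonempty) polyhedron. -/
def IsPolytopalFan (Δ : Set (Set (EuclideanSpace ℝ (Fin d)))) : Prop :=
  ∃ P : Set (EuclideanSpace ℝ (Fin d)), IsPolyhedron P ∧ P.Nonempty ∧ Δ = normalFan P

/-- The one-dimensional cones of `Δ` are exactly the rays spanned by the vectors `v i`,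
and different indices give different rays. -/
def HasRayGenerators (Δ : Set (Set (EuclideanSpace ℝ (Fin d))))
    (v : Fin n → EuclideanSpace ℝ (Fin d)) : Prop :=
  Function.Injective (fun i => posHull ![v i]) ∧
    {σ ∈ Δ | Module.finrank ℝ (Submodule.span ℝ σ) = 1} = Set.range (fun i => posHull ![v i])

/-- The set of all simplicial polytopal fans with ray generators `v`. -/
def simplicialPolytopalFans (v : Fin n → EuclideanSpace ℝ (Fin d)) :
    Set (Set (Set (EuclideanSpace ℝ (Fin d)))) :=
  {Δ | IsPolytopalFan Δ ∧ (∀ σ ∈ Δ, IsSimplicialCone σ) ∧ HasRayGenerators Δ v}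

/-- `P(h) = {x : ⟨x, v i⟩ ≤ h i for all i}`. -/
def polytopeOf (v : Fin n → EuclideanSpace ℝ (Fin d)) (h : Fin n → ℝ) :
    Set (EuclideanSpace ℝ (Fin d)) :=
  {x | ∀ i, ⟪x, v i⟫ ≤ h i}

/-- `h` is compatible if `P(h)` is nonempty. -/
def Compatible (v : Fin n → EuclideanSpace ℝ (Fin d)) (h : Fin n → ℝ) : Prop :=
  (polytopeOf v h).Nonempty

/-- The set `ir(V)` of irredundant vectors: compatible vectors `h` such that removing any one
of the inequalities changes `P(h)`. -/
def irSet (v : Fin n → EuclideanSpace ℝ (Fin d)) : Set (Fin n → ℝ) :=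
  {h | Compatible v h ∧ ∀ i, {x | ∀ j, j ≠ i → ⟪x, v j⟫ ≤ h j} ≠ polytopeOf v h}

/-- The set `clir(V)`, the closure of `ir(V)`. -/
def clir (v : Fin n → EuclideanSpace ℝ (Fin d)) : Set (Fin n → ℝ) :=
  closure (irSet v)

/-- The type cone of `Δ`: the set of all polytopes with normal fan `Δ`, each recorded by its
support vector `(h_P(v 1), …, h_P(v n))`. -/
def typeCone (Δ : Set (Set (EuclideanSpace ℝ (Fin d))))
    (v : Fin n → EuclideanSpace ℝ (Fin d)) : Set (Fin n → ℝ) :=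
  {h | ∃ P : Set (EuclideanSpace ℝ (Fin d)),
    IsPolytope P ∧ P.Nonempty ∧ normalFan P = Δ ∧ h = fun i => supportFun P (v i)}

/-- The deformation cone of `Δ`: the closure of the type cone. -/
def deformationCone (Δ : Set (Set (EuclideanSpace ℝ (Fin d))))
    (v : Fin n → EuclideanSpace ℝ (Fin d)) : Set (Fin n → ℝ) :=
  closure (typeCone Δ v)

/-- The family of the deformation cones of all simplicial polytopal fans with rays `v`. -/
def deformationCones (v : Fin n → EuclideanSpace ℝ (Fin d)) : Set (Set (Fin n → ℝ)) :=
  (fun Δ => deformationCone Δ v) '' simplicialPolytopalFans v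

/-- The least-squares objective `h ↦ (1/m) ∑ᵢ (h_{P(h)}(uᵢ) - yᵢ)²`. -/
def lsObjective (v : Fin n → EuclideanSpace ℝ (Fin d)) (u : Fin m → EuclideanSpace ℝ (Fin d))
    (y : Fin m → ℝ) (h : Fin n → ℝ) : ℝ :=
  (1 / (m : ℝ)) * ∑ i, (supportFun (polytopeOf v h) (u i) - y i) ^ 2

/-- The least-squares estimator: the set of all minimizers of the objective over `clir(V)`. -/
def lsEstimator (v : Fin n → EuclideanSpace ℝ (Fin d)) (u : Fin m → EuclideanSpace ℝ (Fin d))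
    (y : Fin m → ℝ) : Set (Fin n → ℝ) :=
  {h ∈ clir v | IsMinOn (lsObjective v u y) (clir v) h}

/-- `𝒞` is a subdivision of `S` into polyhedral cones: finitely many full-dimensional
polyhedral cones that cover exactly `S` and any two of which meet in a common face. -/
def IsConicalSubdivision (S : Set (Fin n → ℝ)) (𝒞 : Set (Set (Fin n → ℝ))) : Prop :=
  𝒞.Finite ∧ (∀ C ∈ 𝒞, IsPolyhedralCone C ∧ (interior C).Nonempty) ∧ ⋃₀ 𝒞 = S ∧
    ∀ C ∈ 𝒞, ∀ C' ∈ 𝒞, IsExposed ℝ C (C ∩ C') ∧ IsExposed ℝ C' (C ∩ C')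

/-- `f` is piecewise quadratic on `S` with respect to the regions `𝒞`: the cones `𝒞` subdivide
`S`, and on each of them `f` is a polynomial of degree at most two. -/
def IsPiecewiseQuadraticOn (f : (Fin n → ℝ) → ℝ) (S : Set (Fin n → ℝ))
    (𝒞 : Set (Set (Fin n → ℝ))) : Prop :=
  IsConicalSubdivision S 𝒞 ∧
    ∀ C ∈ 𝒞, ∃ q : MvPolynomial (Fin n) ℝ, q.totalDegree ≤ 2 ∧
      ∀ h ∈ C, f h = MvPolynomial.eval h q

end Euclidean

end

noncomputable section

section Euclidean

variable {d n m : ℕ}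

local notation "𝔼" d => EuclideanSpace ℝ (Fin d)

/-! Everything is encoded by bases. A set `I` indexing a basis among the `v i` has a point `vertex v
I h`, linear in `h`, where the inequalities in `I` are tight. Call `h` simple if these are the only
tight inequalities at each such point of `P(h)` and every inequality is tight at one of them. The
fan of `P(h)` then consists of the faces of the cones over `vertexSets v h` (`normalFan_eq`), and it
determines `vertexSets v h` (`IsSimple.vertexSets_eq`). Conversely, a polyhedron whose fan is
simplicial with rays `V` is `P(h)` for its support vector `h`, which is simple
(`eq_polytopeOf_supportFun`, `isSimple_of_hasRayGenerators`).

Hence a type cone is cut out by the strict inequalities `vertexGap v I j h < 0` for `I` in the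
vertex sets and `j ∉ I`, and its closure by the weak ones. There `vertex v I h` still maximizes
every `u` in the cone over `I`, so support functions are linear in `h`
(`supportFun_eq_inner_vertex`) and the objective is quadratic.

The cones cover `clir(V)` because simple heights are dense in it and a finite union of closed cones
is closed. For common faces, compare on one cone the support function of `P(h)` at `∑ i ∈ I, v i`,
which is linear there, with its upper bound `∑ i ∈ I, h i`. They agree exactly when `vertex v I h`
lies in `P(h)`, so summing the differences over the bases of the other cone yields an exposing
functional (`isExposed_weakCone_inter`). -/

theorem eventually_add_mul_le {ι : Type*} [Finite ι] {s t b : ι → ℝ} (hs : ∀ i, s i ≤ b i)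
    (ht : ∀ i, s i = b i → t i ≤ 0) :
    ∀ᶠ ε in nhdsWithin (0 : ℝ) (Set.Ioi 0), ∀ i, s i + ε * t i ≤ b i := by
  rw [Filter.eventually_all]
  intro i
  rcases (hs i).eq_or_lt with h | h
  · filter_upwards [self_mem_nhdsWithin] with ε hε
    have := mul_nonneg (le_of_lt (Set.mem_Ioi.1 hε)) (neg_nonneg.2 (ht i h))
    linarith
  · have hc : Filter.Tendsto (fun ε : ℝ => s i + ε * t i) (nhdsWithin 0 (Set.Ioi 0))
        (nhds (s i + 0 * t i)) :=
      (Continuous.tendsto (by fun_prop) 0).mono_left nhdsWithin_le_nhds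
    rw [zero_mul, add_zero] at hc
    filter_upwards [hc.eventually (gt_mem_nhds h)] with ε hε using hε.le

theorem exists_pos_add_mul_le {ι : Type*} [Finite ι] {s t b : ι → ℝ} (hs : ∀ i, s i ≤ b i)
    (ht : ∀ i, s i = b i → t i ≤ 0) : ∃ ε > 0, ∀ i, s i + ε * t i ≤ b i := by
  obtain ⟨ε, h1, h2⟩ := ((eventually_add_mul_le hs ht).and self_mem_nhdsWithin).exists
  exact ⟨ε, h2, h1⟩

/-- Linear functionals on a linearly independent family can be prescribed. -/
theorem LinearIndependent.exists_inner_eq {ι : Type*} [Fintype ι] {w : ι → 𝔼 d}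
    (hw : LinearIndependent ℝ w) (t : ι → ℝ) : ∃ y : 𝔼 d, ∀ i, ⟪y, w i⟫ = t i := by
  classical
  obtain ⟨g, hg⟩ := LinearMap.exists_leftInverse_of_injective
    (Fintype.linearCombination ℝ w) (LinearMap.ker_eq_bot.2 hw.fintypeLinearCombination_injective)
  have hgi : ∀ i, g (w i) = Pi.single i 1 := by
    intro i
    have := LinearMap.congr_fun hg (Pi.single i 1)
    simpa using this
  let f : (𝔼 d) →ₗ[ℝ] ℝ := (Fintype.linearCombination ℝ t) ∘ₗ g
  refine ⟨(InnerProductSpace.toDual ℝ (𝔼 d)).symm (LinearMap.toContinuousLinearMap f), fun i => ?_⟩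
  rw [InnerProductSpace.toDual_symm_apply]
  simp [f, hgi]

/-! ### Compactness of `P(h)`, exposed faces and support functions. -/

theorem polytopeOf_isClosed (v : Fin n → 𝔼 d) (h : Fin n → ℝ) : IsClosed (polytopeOf v h) := by
  simp only [polytopeOf, Set.ofPred_forall]
  exact isClosed_iInter fun i => isClosed_le (by fun_prop) continuous_const

/-- Every `u` is a nonnegative combination of the `v i`, so the same combination of the `h i` bounds
`⟪·, u⟫` on `P(h)`. Taking `u` to be plus and minus the coordinate vectors bounds the norm. -/
theorem polytopeOf_isBounded {v : Fin n → 𝔼 d} (hv : PositivelySpanning v) (h : Fin n → ℝ) :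
    Bornology.IsBounded (polytopeOf v h) := by
  have key : ∀ u : 𝔼 d, ∃ B : ℝ, ∀ x ∈ polytopeOf v h, ⟪x, u⟫ ≤ B := by
    intro u
    obtain ⟨c, hc, rfl⟩ : u ∈ posHull v := hv ▸ Set.mem_univ u
    refine ⟨∑ i, c i * h i, fun x hx => ?_⟩
    simp only [inner_sum, inner_smul_right]
    exact Finset.sum_le_sum fun i _ => mul_le_mul_of_nonneg_left (hx i) (hc i)
  choose B hB using key
  rw [isBounded_iff_forall_norm_le]
  refine ⟨∑ k, max (B (EuclideanSpace.basisFun (Fin d) ℝ k))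
    (B (-EuclideanSpace.basisFun (Fin d) ℝ k)), fun x hx => ?_⟩
  have hx' : x = ∑ k, ⟪EuclideanSpace.basisFun (Fin d) ℝ k, x⟫ •
      EuclideanSpace.basisFun (Fin d) ℝ k :=
    ((EuclideanSpace.basisFun (Fin d) ℝ).sum_repr' x).symm
  rw [hx']
  refine (norm_sum_le _ _).trans (Finset.sum_le_sum fun k _ => ?_)
  rw [norm_smul, OrthonormalBasis.norm_eq_one, mul_one, Real.norm_eq_abs, abs_le', real_inner_comm]
  refine ⟨(hB _ x hx).trans (le_max_left _ _), ?_⟩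
  have := hB (-EuclideanSpace.basisFun (Fin d) ℝ k) x hx
  rw [inner_neg_right] at this
  exact this.trans (le_max_right _ _)

theorem polytopeOf_isCompact {v : Fin n → 𝔼 d} (hv : PositivelySpanning v) (h : Fin n → ℝ) :
    IsCompact (polytopeOf v h) :=
  Metric.isCompact_of_isClosed_isBounded (polytopeOf_isClosed v h) (polytopeOf_isBounded hv h)

theorem polytopeOf_isPolyhedron (v : Fin n → 𝔼 d) (h : Fin n → ℝ) :
    IsPolyhedron (polytopeOf v h) :=
  ⟨n, fun j => (innerSL ℝ (v j)).toLinearMap, h, by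
    ext x; simp [polytopeOf, real_inner_comm]⟩

/-- The set of points of `P` at which `⟪u, ·⟫` is maximal. -/
def maxFace (P : Set (𝔼 d)) (u : 𝔼 d) : Set (𝔼 d) := {x ∈ P | ∀ y ∈ P, ⟪u, y⟫ ≤ ⟪u, x⟫}

theorem maxFace_isExposed (P : Set (𝔼 d)) (u : 𝔼 d) : IsExposed ℝ P (maxFace P u) :=
  fun _ => ⟨innerSL ℝ u, by ext x; simp [maxFace]⟩

theorem exists_eq_maxFace {P F : Set (𝔼 d)} (hF : F.Nonempty) (h : IsExposed ℝ P F) :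
    ∃ u, F = maxFace P u := by
  obtain ⟨l, rfl⟩ := h hF
  refine ⟨(InnerProductSpace.toDual ℝ (𝔼 d)).symm l, ?_⟩
  ext x
  simp [maxFace]

theorem mem_normalFan_iff {P N : Set (𝔼 d)} :
    N ∈ normalFan P ↔ ∃ u, (maxFace P u).Nonempty ∧ N = normalCone P (maxFace P u) := by
  constructor
  · rintro ⟨F, hF, hF', rfl⟩
    obtain ⟨u, rfl⟩ := exists_eq_maxFace hF hF'
    exact ⟨u, hF, rfl⟩
  · rintro ⟨u, hu, rfl⟩
    exact ⟨_, hu, maxFace_isExposed P u, rfl⟩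

theorem mem_normalCone_maxFace (P : Set (𝔼 d)) (u : 𝔼 d) : u ∈ normalCone P (maxFace P u) :=
  fun _ hp => hp.2

theorem maxFace_nonempty {P : Set (𝔼 d)} (hP : IsCompact P) (hne : P.Nonempty) (u : 𝔼 d) :
    (maxFace P u).Nonempty := by
  obtain ⟨x, hx, hmax⟩ := hP.exists_isMaxOn hne (f := fun y => ⟪u, y⟫) (by fun_prop)
  exact ⟨x, hx, fun y hy => hmax hy⟩

theorem supportFun_eq {P : Set (𝔼 d)} {u x : 𝔼 d} (hx : x ∈ maxFace P u) :
    supportFun P u = ⟪u, x⟫ :=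
  IsGreatest.csSup_eq ⟨⟨x, hx.1, rfl⟩, by rintro _ ⟨y, hy, rfl⟩; exact hx.2 y hy⟩

/-! ### Bases among the `v i` and their dual families. -/

/-- `I` indexes a basis: there is a dual family. -/
def IsBasisSet (v : Fin n → 𝔼 d) (I : Finset (Fin n)) : Prop :=
  ∃ w : Fin n → 𝔼 d, (∀ i ∈ I, ∀ j ∈ I, ⟪w i, v j⟫ = if i = j then 1 else 0) ∧
    ∀ u, u = ∑ i ∈ I, ⟪w i, u⟫ • v i

open Classical in
/-- The dual family of the basis indexed by `I`. -/
def dualVec (v : Fin n → 𝔼 d) (I : Finset (Fin n)) : Fin n → 𝔼 d :=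
  if h : IsBasisSet v I then h.choose else 0

/-- The point at which the inequalities indexed by the basis `I` are tight. -/
def vertex (v : Fin n → 𝔼 d) (I : Finset (Fin n)) (h : Fin n → ℝ) : 𝔼 d :=
  ∑ i ∈ I, h i • dualVec v I i

theorem inner_vertex (v : Fin n → 𝔼 d) (I : Finset (Fin n)) (h : Fin n → ℝ) (u : 𝔼 d) :
    ⟪vertex v I h, u⟫ = ∑ i ∈ I, ⟪dualVec v I i, u⟫ * h i := by
  simp [vertex, sum_inner, inner_smul_left, mul_comm]

theorem continuous_vertex (v : Fin n → 𝔼 d) (I : Finset (Fin n)) : Continuous (vertex v I) := by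
  unfold vertex
  fun_prop

namespace IsBasisSet

variable {v : Fin n → 𝔼 d} {I J : Finset (Fin n)}

theorem inner_dualVec (hI : IsBasisSet v I) {i j : Fin n} (hi : i ∈ I) (hj : j ∈ I) :
    ⟪dualVec v I i, v j⟫ = if i = j then 1 else 0 := by
  rw [dualVec, dif_pos hI]
  exact hI.choose_spec.1 i hi j hj

theorem sum_dualVec (hI : IsBasisSet v I) (u : 𝔼 d) :
    u = ∑ i ∈ I, ⟪dualVec v I i, u⟫ • v i := by
  rw [dualVec, dif_pos hI]
  exact hI.choose_spec.2 u

theorem inner_dualVec_sum (hI : IsBasisSet v I) (hJ : J ⊆ I) {i : Fin n} (hi : i ∈ I)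
    (c : Fin n → ℝ) :
    ⟪dualVec v I i, ∑ j ∈ J, c j • v j⟫ = if i ∈ J then c i else 0 := by
  have : ∀ j ∈ J, ⟪dualVec v I i, c j • v j⟫ = if i = j then c i else 0 := by
    intro j hj
    rw [inner_smul_right, hI.inner_dualVec hi (hJ hj)]
    by_cases h : i = j <;> simp [h]
  rw [inner_sum, Finset.sum_congr rfl this, Finset.sum_ite_eq]

theorem inner_vertex_of_mem (hI : IsBasisSet v I) (h : Fin n → ℝ) {j : Fin n} (hj : j ∈ I) :
    ⟪vertex v I h, v j⟫ = h j := by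
  have : ∀ i ∈ I, ⟪dualVec v I i, v j⟫ * h i = if i = j then h i else 0 := by
    intro i hi
    rw [hI.inner_dualVec hi hj]
    by_cases h : i = j <;> simp [h]
  rw [inner_vertex, Finset.sum_congr rfl this]
  simp [hj]

theorem eq_vertex (hI : IsBasisSet v I) {h : Fin n → ℝ} {x : 𝔼 d}
    (hx : ∀ i ∈ I, ⟪x, v i⟫ = h i) : x = vertex v I h := by
  refine ext_inner_right ℝ fun u => ?_
  rw [inner_vertex]
  conv_lhs => rw [hI.sum_dualVec u, inner_sum]
  refine Finset.sum_congr rfl fun i hi => ?_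
  rw [inner_smul_right, hx i hi]

theorem eq_of_subset (hI : IsBasisSet v I) (hJ : IsBasisSet v J) (h : I ⊆ J) : I = J := by
  refine h.antisymm fun j hj => ?_
  by_contra hjI
  have h1 := hJ.inner_dualVec hj hj
  rw [hI.sum_dualVec (v j), hJ.inner_dualVec_sum h hj, if_neg hjI] at h1
  simp at h1

theorem linearIndependent (hI : IsBasisSet v I) (hJ : J ⊆ I) :
    LinearIndependent ℝ (fun i : J => v i) := by
  rw [Fintype.linearIndependent_iff]
  intro g hg i
  classical
  let c : Fin n → ℝ := fun j => if hj : j ∈ J then g ⟨j, hj⟩ else 0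
  have : ∑ j ∈ J, c j • v j = 0 := by
    rw [← hg, ← Finset.sum_coe_sort J]
    exact Finset.sum_congr rfl fun j _ => by simp [c]
  have h2 := hI.inner_dualVec_sum hJ (hJ i.2) c
  rw [this, inner_zero_right, if_pos i.2] at h2
  simpa [c] using h2.symm

end IsBasisSet

theorem exists_isBasisSet (v : Fin n → 𝔼 d) (A : Set (Fin n))
    (hA : Submodule.span ℝ (v '' A) = ⊤) : ∃ I, IsBasisSet v I ∧ ∀ i ∈ I, i ∈ A := by
  classical
  obtain ⟨b, hbA, -, hspan, hli⟩ := exists_linearIndepOn_extension (v := v) (K := ℝ)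
    (linearIndepOn_empty ℝ v) (Set.empty_subset A)
  have hw : ∀ i : Fin n, ∃ y : 𝔼 d, ∀ j : b, ⟪y, v j⟫ = if i = j then 1 else 0 := fun i =>
    LinearIndependent.exists_inner_eq hli fun j => if i = j then 1 else 0
  choose w hw using hw
  refine ⟨b.toFinset, ⟨w, fun i _ j hj => hw i ⟨j, by simpa using hj⟩, fun u => ?_⟩,
    fun i hi => hbA (by simpa using hi)⟩
  have hu : u ∈ Submodule.span ℝ (v '' b) := by
    have : Submodule.span ℝ (v '' A) ≤ Submodule.span ℝ (v '' b) := Submodule.span_le.2 hspan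
    exact this (hA ▸ Submodule.mem_top)
  induction hu using Submodule.span_induction with
  | mem x hx =>
    obtain ⟨j, hj, rfl⟩ := hx
    have : ∀ i ∈ b.toFinset, ⟪w i, v j⟫ • v i = if i = j then v i else 0 := by
      intro i _
      rw [hw i ⟨j, hj⟩]
      by_cases h : i = j <;> simp [h]
    rw [Finset.sum_congr rfl this]
    simp [hj]
  | zero => simp
  | add x y _ _ hx hy =>
    simp only [inner_add_right, add_smul, Finset.sum_add_distrib]
    rw [← hx, ← hy]
  | smul a x _ hx =>
    simp only [inner_smul_right, mul_smul]
    rw [← Finset.smul_sum, ← hx]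

/-! ### Vertices and normal cones. -/

/-- The index sets of the bases whose vertex lies in `P(h)`. -/
def vertexSets (v : Fin n → 𝔼 d) (h : Fin n → ℝ) : Set (Finset (Fin n)) :=
  {I | IsBasisSet v I ∧ vertex v I h ∈ polytopeOf v h}

/-- Every vertex of `P(h)` lies on exactly `d` of the hyperplanes. -/
def IsNondegenerate (v : Fin n → 𝔼 d) (h : Fin n → ℝ) : Prop :=
  ∀ I ∈ vertexSets v h, ∀ j, ⟪vertex v I h, v j⟫ = h j → j ∈ I

/-- `P(h)` is a nonempty simple polytope and each of the inequalities defines a facet. -/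
structure IsSimple (v : Fin n → 𝔼 d) (h : Fin n → ℝ) : Prop where
  nonempty : (polytopeOf v h).Nonempty
  nondegenerate : IsNondegenerate v h
  exists_mem : ∀ j, ∃ I ∈ vertexSets v h, j ∈ I

/-- The cone generated by the vectors `v i` for `i ∈ J`. -/
def faceCone (v : Fin n → 𝔼 d) (J : Finset (Fin n)) : Set (𝔼 d) :=
  {x | ∃ c : Fin n → ℝ, (∀ i ∈ J, 0 ≤ c i) ∧ x = ∑ i ∈ J, c i • v i}

theorem mem_polytopeOf_add_smul {v : Fin n → 𝔼 d} {h : Fin n → ℝ} {x y : 𝔼 d}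
    (hx : x ∈ polytopeOf v h) (hy : ∀ i, ⟪x, v i⟫ = h i → ⟪y, v i⟫ ≤ 0) :
    ∃ ε > (0 : ℝ), x + ε • y ∈ polytopeOf v h := by
  obtain ⟨ε, hε, H⟩ := exists_pos_add_mul_le (s := fun i => ⟪x, v i⟫) hx hy
  refine ⟨ε, hε, fun i => ?_⟩
  rw [inner_add_left, real_inner_smul_left]
  exact H i

/-- A compact face has an extreme point, which is also extreme in `P(h)`. If the normals tight there
did not span, a vector orthogonal to them would give a segment in `P(h)` around the point. -/
theorem exists_vertex_mem_maxFace {v : Fin n → 𝔼 d} (hv : PositivelySpanning v) {h : Fin n → ℝ}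
    (hne : (polytopeOf v h).Nonempty) (u : 𝔼 d) :
    ∃ I ∈ vertexSets v h, vertex v I h ∈ maxFace (polytopeOf v h) u := by
  have hc := polytopeOf_isCompact hv h
  have hF := maxFace_isExposed (polytopeOf v h) u
  obtain ⟨x, hx⟩ := (hF.isCompact hc).extremePoints_nonempty (maxFace_nonempty hc hne u)
  have hxF := hx.1
  have hxe : x ∈ (polytopeOf v h).extremePoints ℝ :=
    hF.isExtreme.extremePoints_subset_extremePoints hx
  have hspan : Submodule.span ℝ (v '' {i | ⟪x, v i⟫ = h i}) = ⊤ := by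
    by_contra hne
    obtain ⟨y, hy, hy0⟩ := (Submodule.ne_bot_iff _).1
      (mt (Submodule.orthogonal_eq_bot_iff).1 hne)
    have hy' : ∀ i, ⟪x, v i⟫ = h i → ⟪y, v i⟫ = 0 := fun i hi =>
      (Submodule.mem_orthogonal' _ y).1 hy _ (Submodule.subset_span ⟨i, hi, rfl⟩)
    obtain ⟨ε, hε, h1⟩ := mem_polytopeOf_add_smul hxF.1 fun i hi => (hy' i hi).le
    obtain ⟨δ, hδ, h2⟩ := mem_polytopeOf_add_smul (y := -y) hxF.1 fun i hi => by
      rw [inner_neg_left, hy' i hi, neg_zero]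
    have hmem : x ∈ openSegment ℝ (x + ε • y) (x + δ • -y) := by
      -- The weights are proportional to the opposite step lengths, so the two displacements along
      -- `y` cancel.
      refine ⟨δ / (ε + δ), ε / (ε + δ), by positivity, by positivity, ?_, ?_⟩
      · field_simp; ring
      · have h3 : δ / (ε + δ) + ε / (ε + δ) = 1 := by field_simp; ring
        have h4 : δ / (ε + δ) * ε = ε / (ε + δ) * δ := by ring
        calc _ = (δ / (ε + δ) + ε / (ε + δ)) • x + (δ / (ε + δ) * ε - ε / (ε + δ) * δ) • y := by
              module
          _ = x := by rw [h3, h4]; module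
    have := hxe.2 h1 h2 hmem
    have : ε • y = 0 := by simpa using this
    exact hy0 ((smul_eq_zero.1 this).resolve_left hε.ne')
  obtain ⟨I, hI, hIA⟩ := exists_isBasisSet v _ hspan
  have hxI := hI.eq_vertex hIA
  exact ⟨I, ⟨hI, hxI ▸ hxF.1⟩, hxI ▸ hxF⟩

/-- The normal cone at a simple vertex. -/
theorem inner_dualVec_nonneg {v : Fin n → 𝔼 d} {h : Fin n → ℝ} {I : Finset (Fin n)}
    (hI : I ∈ vertexSets v h) (hd : ∀ j, ⟪vertex v I h, v j⟫ = h j → j ∈ I) {u : 𝔼 d}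
    (hu : vertex v I h ∈ maxFace (polytopeOf v h) u) {i : Fin n} (hi : i ∈ I) :
    0 ≤ ⟪dualVec v I i, u⟫ := by
  obtain ⟨ε, hε, H⟩ := mem_polytopeOf_add_smul (y := -dualVec v I i) hI.2 fun j hj => by
    rw [inner_neg_left, hI.1.inner_dualVec hi (hd j hj)]
    split_ifs <;> simp
  have h1 := hu.2 _ H
  rw [inner_add_right, inner_smul_right, inner_neg_right, real_inner_comm (dualVec v I i) u] at h1
  nlinarith

theorem mem_faceCone_of_mem_maxFace {v : Fin n → 𝔼 d} {h : Fin n → ℝ} {I : Finset (Fin n)}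
    (hI : I ∈ vertexSets v h) (hd : ∀ j, ⟪vertex v I h, v j⟫ = h j → j ∈ I) {u : 𝔼 d}
    (hu : vertex v I h ∈ maxFace (polytopeOf v h) u) : u ∈ faceCone v I :=
  ⟨_, fun _ hi => inner_dualVec_nonneg hI hd hu hi, hI.1.sum_dualVec u⟩

theorem IsNondegenerate.exists_mem_faceCone {v : Fin n → 𝔼 d} {h : Fin n → ℝ}
    (hh : IsNondegenerate v h) (hv : PositivelySpanning v) (hne : (polytopeOf v h).Nonempty)
    (u : 𝔼 d) : ∃ I ∈ vertexSets v h, u ∈ faceCone v I := by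
  obtain ⟨I, hI, hu⟩ := exists_vertex_mem_maxFace hv hne u
  exact ⟨I, hI, mem_faceCone_of_mem_maxFace hI (hh I hI) hu⟩

theorem inner_le_of_mem_polytopeOf {v : Fin n → 𝔼 d} {h : Fin n → ℝ} {J : Finset (Fin n)}
    {c : Fin n → ℝ} (hc : ∀ i ∈ J, 0 ≤ c i) {x : 𝔼 d} (hx : x ∈ polytopeOf v h) :
    ⟪∑ i ∈ J, c i • v i, x⟫ ≤ ∑ i ∈ J, c i * h i := by
  simp only [sum_inner, real_inner_smul_left]
  exact Finset.sum_le_sum fun i hi =>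
    mul_le_mul_of_nonneg_left (real_inner_comm (v i) x ▸ hx i) (hc i hi)

theorem inner_eq_of_tight {v : Fin n → 𝔼 d} {h : Fin n → ℝ} {J : Finset (Fin n)}
    (c : Fin n → ℝ) {x : 𝔼 d} (hx : ∀ i ∈ J, ⟪x, v i⟫ = h i) :
    ⟪∑ i ∈ J, c i • v i, x⟫ = ∑ i ∈ J, c i * h i := by
  simp only [sum_inner, real_inner_smul_left]
  exact Finset.sum_congr rfl fun i hi => by rw [real_inner_comm, hx i hi]

theorem mem_maxFace_of_tight {v : Fin n → 𝔼 d} {h : Fin n → ℝ} {J : Finset (Fin n)}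
    {c : Fin n → ℝ} (hc : ∀ i ∈ J, 0 ≤ c i) {x : 𝔼 d} (hx : x ∈ polytopeOf v h)
    (ht : ∀ i ∈ J, ⟪x, v i⟫ = h i) : x ∈ maxFace (polytopeOf v h) (∑ i ∈ J, c i • v i) :=
  ⟨hx, fun _ hy => (inner_le_of_mem_polytopeOf hc hy).trans (inner_eq_of_tight c ht).ge⟩

theorem vertex_mem_maxFace {v : Fin n → 𝔼 d} {h : Fin n → ℝ} {I J : Finset (Fin n)}
    (hI : I ∈ vertexSets v h) (hJ : J ⊆ I) {u : 𝔼 d} (hu : u ∈ faceCone v J) :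
    vertex v I h ∈ maxFace (polytopeOf v h) u := by
  obtain ⟨c, hc, rfl⟩ := hu
  exact mem_maxFace_of_tight hc hI.2 fun i hi => hI.1.inner_vertex_of_mem h (hJ hi)

/-- The vertex attains the bound `∑ i ∈ J, c i * h i`; as each `c i` is positive, slack in any one
inequality would make the value smaller. -/
theorem tight_of_mem_maxFace {v : Fin n → 𝔼 d} {h : Fin n → ℝ} {I J : Finset (Fin n)}
    (hI : I ∈ vertexSets v h) (hJ : J ⊆ I) {c : Fin n → ℝ} (hc : ∀ i ∈ J, 0 < c i) {x : 𝔼 d}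
    (hx : x ∈ maxFace (polytopeOf v h) (∑ i ∈ J, c i • v i)) : ∀ i ∈ J, ⟪x, v i⟫ = h i := by
  have h1 := hx.2 _ hI.2
  rw [inner_eq_of_tight c fun i hi => hI.1.inner_vertex_of_mem h (hJ hi)] at h1
  by_contra! hcon
  obtain ⟨i, hi, hne⟩ := hcon
  refine absurd h1 (not_le.2 ?_)
  simp only [sum_inner, real_inner_smul_left]
  refine Finset.sum_lt_sum (fun j hj => mul_le_mul_of_nonneg_left
    (real_inner_comm (v j) x ▸ hx.1 j) (hc j hj).le) ⟨i, hi, mul_lt_mul_of_pos_left ?_ (hc i hi)⟩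
  rw [real_inner_comm]
  exact lt_of_le_of_ne (hx.1 i) hne

/-- The normal cone at the face cut out by `J` of a polytope with a simple vertex on it. -/
theorem normalCone_eq_faceCone {v : Fin n → 𝔼 d} {h : Fin n → ℝ} {I J : Finset (Fin n)}
    (hI : I ∈ vertexSets v h) (hd : ∀ j, ⟪vertex v I h, v j⟫ = h j → j ∈ I) (hJ : J ⊆ I)
    {c : Fin n → ℝ} (hc : ∀ i ∈ J, 0 < c i) :
    normalCone (polytopeOf v h) (maxFace (polytopeOf v h) (∑ i ∈ J, c i • v i)) =
      faceCone v J := by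
  ext z
  constructor
  · intro hz
    have hx := vertex_mem_maxFace hI hJ ⟨c, fun i hi => (hc i hi).le, rfl⟩
    have hzx : vertex v I h ∈ maxFace (polytopeOf v h) z := ⟨hI.2, hz _ hx⟩
    have hz0 : ∀ i ∈ I, i ∉ J → ⟪dualVec v I i, z⟫ = 0 := by
      intro i hi hiJ
      refine le_antisymm ?_ (inner_dualVec_nonneg hI hd hzx hi)
      -- For `i ∉ J` the direction `-dualVec v I i` keeps the inequalities of `J` tight, so the
      -- moved point stays on the face. Since `z` is maximal there too, its coefficient at `i`
      -- cannot be positive.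
      obtain ⟨ε, hε, H⟩ := mem_polytopeOf_add_smul (y := -dualVec v I i) hI.2 fun j hj => by
        rw [inner_neg_left, hI.1.inner_dualVec hi (hd j hj)]
        split_ifs <;> simp
      have h1 := hz _ (mem_maxFace_of_tight (c := c) (J := J) (fun i hi => (hc i hi).le) H
        fun j hj => by
          rw [inner_add_left, real_inner_smul_left, inner_neg_left,
            hI.1.inner_dualVec hi (hJ hj), hI.1.inner_vertex_of_mem h (hJ hj),
            if_neg (by rintro rfl; exact hiJ hj)]
          simp) _ hI.2
      rw [inner_add_right, inner_smul_right, inner_neg_right, real_inner_comm (dualVec v I i) z] at h1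
      nlinarith
    refine ⟨fun i => ⟪dualVec v I i, z⟫,
      fun i hi => inner_dualVec_nonneg hI hd hzx (hJ hi), ?_⟩
    conv_lhs => rw [hI.1.sum_dualVec z]
    refine (Finset.sum_subset hJ fun i hi hiJ => ?_).symm
    rw [hz0 i hi hiJ, zero_smul]
  · rintro ⟨b, hb, rfl⟩ p hp y hy
    exact (mem_maxFace_of_tight hb hp.1 (tight_of_mem_maxFace hI hJ hc hp)).2 y hy

theorem exists_pos_of_mem_faceCone {v : Fin n → 𝔼 d} {I : Finset (Fin n)} {u : 𝔼 d}
    (hu : u ∈ faceCone v I) :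
    ∃ J ⊆ I, ∃ c : Fin n → ℝ, (∀ i ∈ J, 0 < c i) ∧ u = ∑ i ∈ J, c i • v i := by
  classical
  obtain ⟨c, hc, rfl⟩ := hu
  refine ⟨{i ∈ I | 0 < c i}, Finset.filter_subset _ _, c, fun i hi => (Finset.mem_filter.1 hi).2,
    (Finset.sum_subset (Finset.filter_subset _ _) fun i hi hni => ?_).symm⟩
  have : c i = 0 := by
    by_contra hne
    exact hni (Finset.mem_filter.2 ⟨hi, lt_of_le_of_ne (hc i hi) (Ne.symm hne)⟩)
  rw [this, zero_smul]

/-- The normal fan of a simple polytope consists of the faces of the cones of its vertices. -/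
theorem normalFan_eq {v : Fin n → 𝔼 d} {h : Fin n → ℝ} (hv : PositivelySpanning v)
    (hne : (polytopeOf v h).Nonempty) (hh : IsNondegenerate v h) :
    normalFan (polytopeOf v h) = {σ | ∃ I ∈ vertexSets v h, ∃ J ⊆ I, σ = faceCone v J} := by
  ext σ
  rw [mem_normalFan_iff]
  constructor
  · rintro ⟨u, hu, rfl⟩
    obtain ⟨I, hI, huI⟩ := hh.exists_mem_faceCone hv hne u
    obtain ⟨J, hJ, c, hc, rfl⟩ := exists_pos_of_mem_faceCone huI
    exact ⟨I, hI, J, hJ, normalCone_eq_faceCone hI (hh I hI) hJ hc⟩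
  · rintro ⟨I, hI, J, hJ, rfl⟩
    exact ⟨_, maxFace_nonempty (polytopeOf_isCompact hv h) hne _,
      (normalCone_eq_faceCone hI (hh I hI) hJ (c := 1) fun _ _ => one_pos).symm⟩

/-! ### The normal fan of a simple polytope is simplicial with rays `V`. -/

theorem posHull_singleton (w : 𝔼 d) : posHull ![w] = {x | ∃ c : ℝ, 0 ≤ c ∧ x = c • w} := by
  ext x
  constructor
  · rintro ⟨c, hc, rfl⟩
    exact ⟨c 0, hc 0, by simp⟩
  · rintro ⟨c, hc, rfl⟩
    exact ⟨fun _ => c, fun _ => hc, by simp⟩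

theorem faceCone_singleton (v : Fin n → 𝔼 d) (i : Fin n) : faceCone v {i} = posHull ![v i] := by
  rw [posHull_singleton]
  ext x
  constructor
  · rintro ⟨c, hc, rfl⟩
    exact ⟨c i, hc i (by simp), by simp⟩
  · rintro ⟨c, hc, rfl⟩
    exact ⟨fun _ => c, fun _ _ => hc, by simp⟩

theorem mem_faceCone (v : Fin n → 𝔼 d) {i : Fin n} {J : Finset (Fin n)} (hi : i ∈ J) :
    v i ∈ faceCone v J := by
  classical
  exact ⟨Pi.single i 1, fun j _ => by by_cases h : j = i <;> simp [h], by
    simp [Pi.single_apply, hi]⟩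

theorem isSimplicialCone_faceCone {v : Fin n → 𝔼 d} {J : Finset (Fin n)}
    (hJ : LinearIndependent ℝ (fun i : J => v i)) : IsSimplicialCone (faceCone v J) := by
  classical
  refine ⟨J.card, fun k => v (J.equivFin.symm k), hJ.comp _ J.equivFin.symm.injective, ?_⟩
  ext x
  constructor
  · rintro ⟨c, hc, rfl⟩
    refine ⟨fun k => c (J.equivFin.symm k), fun k => hc _ (J.equivFin.symm k).2, ?_⟩
    rw [Equiv.sum_comp J.equivFin.symm (fun i : J => c i • v i), ← Finset.sum_coe_sort J]
  · rintro ⟨c, hc, rfl⟩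
    refine ⟨fun i => if hi : i ∈ J then c (J.equivFin ⟨i, hi⟩) else 0, fun i hi => ?_, ?_⟩
    · simp only [dif_pos hi]; exact hc _
    · rw [← Finset.sum_coe_sort J, ← Equiv.sum_comp J.equivFin.symm]
      simp

theorem span_faceCone (v : Fin n → 𝔼 d) (J : Finset (Fin n)) :
    Submodule.span ℝ (faceCone v J) = Submodule.span ℝ (Set.range fun i : J => v i) := by
  refine le_antisymm (Submodule.span_le.2 ?_) (Submodule.span_le.2 ?_)
  · rintro _ ⟨c, -, rfl⟩
    exact Submodule.sum_mem _ fun i hi =>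
      Submodule.smul_mem _ _ (Submodule.subset_span ⟨⟨i, hi⟩, rfl⟩)
  · rintro _ ⟨i, rfl⟩
    exact Submodule.subset_span (mem_faceCone v i.2)

theorem finrank_span_faceCone {v : Fin n → 𝔼 d} {J : Finset (Fin n)}
    (hJ : LinearIndependent ℝ (fun i : J => v i)) :
    Module.finrank ℝ (Submodule.span ℝ (faceCone v J)) = J.card := by
  rw [span_faceCone, finrank_span_eq_card hJ, Fintype.card_coe]

namespace IsSimple

variable {v : Fin n → 𝔼 d} {h : Fin n → ℝ}

/-- The vertex of `I` maximizes `v i`, and the maximum is `h i` because some vertex attains it;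
nondegeneracy gives `i ∈ I`, and linear independence then gives `i ∈ J`. -/
theorem mem_of_mem_faceCone (hh : IsSimple v h) {I J : Finset (Fin n)} (hI : I ∈ vertexSets v h)
    (hJ : J ⊆ I) {i : Fin n} (hi : v i ∈ faceCone v J) : i ∈ J := by
  have hiI : i ∈ I := by
    refine hh.nondegenerate I hI i (le_antisymm (hI.2 i) ?_)
    obtain ⟨I', hI', hi'⟩ := hh.exists_mem i
    have := (vertex_mem_maxFace hI hJ hi).2 _ hI'.2
    rwa [real_inner_comm, hI'.1.inner_vertex_of_mem h hi', real_inner_comm] at this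
  by_contra hiJ
  obtain ⟨c, -, hc⟩ := hi
  have h1 := hI.1.inner_dualVec hiI hiI
  rw [hc, hI.1.inner_dualVec_sum hJ hiI, if_neg hiJ] at h1
  simp at h1

theorem mem_maxFace (hh : IsSimple v h) (i : Fin n) :
    ∃ x ∈ maxFace (polytopeOf v h) (v i), ⟪x, v i⟫ = h i := by
  obtain ⟨I, hI, hi⟩ := hh.exists_mem i
  exact ⟨_, vertex_mem_maxFace hI subset_rfl (mem_faceCone v hi), hI.1.inner_vertex_of_mem h hi⟩

theorem normalFan_mem (hv : PositivelySpanning v) (hh : IsSimple v h) :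
    normalFan (polytopeOf v h) ∈ simplicialPolytopalFans v := by
  refine ⟨⟨_, polytopeOf_isPolyhedron v h, hh.nonempty, rfl⟩, fun σ hσ => ?_, ?_, ?_⟩
  · rw [normalFan_eq hv hh.nonempty hh.nondegenerate] at hσ
    obtain ⟨I, hI, J, hJ, rfl⟩ := hσ
    exact isSimplicialCone_faceCone (hI.1.linearIndependent hJ)
  · intro i j hij
    simp only at hij
    rw [← faceCone_singleton, ← faceCone_singleton] at hij
    obtain ⟨I, hI, hj⟩ := hh.exists_mem j
    have := hh.mem_of_mem_faceCone hI (J := {j}) (by simpa using hj)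
      (hij ▸ mem_faceCone v (Finset.mem_singleton_self i))
    simpa using this
  · rw [normalFan_eq hv hh.nonempty hh.nondegenerate]
    ext σ
    constructor
    · rintro ⟨⟨I, hI, J, hJ, rfl⟩, hr⟩
      rw [finrank_span_faceCone (hI.1.linearIndependent hJ), Finset.card_eq_one] at hr
      obtain ⟨i, rfl⟩ := hr
      exact ⟨i, (faceCone_singleton v i).symm⟩
    · rintro ⟨i, rfl⟩
      obtain ⟨I, hI, hi⟩ := hh.exists_mem i
      have hiI : {i} ⊆ I := by simpa using hi
      simp only
      rw [← faceCone_singleton]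
      refine ⟨⟨I, hI, {i}, hiI, rfl⟩, ?_⟩
      rw [finrank_span_faceCone (hI.1.linearIndependent hiI),
        Finset.card_singleton]

theorem mem_typeCone (hv : PositivelySpanning v) (hh : IsSimple v h) :
    h ∈ typeCone (normalFan (polytopeOf v h)) v := by
  refine ⟨_, ⟨polytopeOf_isPolyhedron v h, polytopeOf_isBounded hv h⟩, hh.nonempty, rfl, ?_⟩
  funext i
  obtain ⟨x, hx, hxi⟩ := hh.mem_maxFace i
  rw [supportFun_eq hx, real_inner_comm, hxi]

/-- The cone over `I` reappears as a face of the cone over some `I'`. Its generators put `I` inside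
`I'`, and nested bases are equal. -/
theorem vertexSets_subset {h' : Fin n → ℝ} (hv : PositivelySpanning v) (hh : IsSimple v h)
    (hh' : IsSimple v h') (heq : normalFan (polytopeOf v h) = normalFan (polytopeOf v h')) :
    vertexSets v h ⊆ vertexSets v h' := by
  intro I hI
  have h1 : faceCone v I ∈ normalFan (polytopeOf v h) := by
    rw [normalFan_eq hv hh.nonempty hh.nondegenerate]
    exact ⟨I, hI, I, subset_rfl, rfl⟩
  rw [heq, normalFan_eq hv hh'.nonempty hh'.nondegenerate] at h1
  obtain ⟨I', hI', J, hJ, hIJ⟩ := h1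
  have h2 : I ⊆ I' := fun i hi =>
    hJ (hh'.mem_of_mem_faceCone hI' hJ (hIJ ▸ mem_faceCone v hi))
  rwa [hI.1.eq_of_subset hI'.1 h2]

theorem vertexSets_eq {h' : Fin n → ℝ} (hv : PositivelySpanning v) (hh : IsSimple v h)
    (hh' : IsSimple v h') (heq : normalFan (polytopeOf v h) = normalFan (polytopeOf v h')) :
    vertexSets v h = vertexSets v h' :=
  (hh.vertexSets_subset hv hh' heq).antisymm (hh'.vertexSets_subset hv hh heq.symm)

end IsSimple

/-! ### From a simplicial fan back to a simple polytope. -/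

theorem IsPolyhedron.exists_inner {P : Set (𝔼 d)} (hP : IsPolyhedron P) :
    ∃ (k : ℕ) (a : Fin k → 𝔼 d) (b : Fin k → ℝ), P = polytopeOf a b := by
  obtain ⟨k, a, b, rfl⟩ := hP
  refine ⟨k, fun j => (InnerProductSpace.toDual ℝ (𝔼 d)).symm
    (LinearMap.toContinuousLinearMap (a j)), b, ?_⟩
  ext x
  refine forall_congr' fun j => ?_
  rw [real_inner_comm, InnerProductSpace.toDual_symm_apply]
  rfl

/-- A relative interior point of a face of a polyhedron. -/
theorem exists_normalCone_maxFace_eq {k : ℕ} {a : Fin k → 𝔼 d} {b : Fin k → ℝ} {u : 𝔼 d}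
    (hne : (maxFace (polytopeOf a b) u).Nonempty) :
    ∃ x ∈ maxFace (polytopeOf a b) u,
      normalCone (polytopeOf a b) (maxFace (polytopeOf a b) u) =
        normalCone (polytopeOf a b) {x} := by
  classical
  -- A point of the face with a minimal set of tight inequalities plays the role of a relative
  -- interior point.
  obtain ⟨x, hx, hmin⟩ := exists_minimal_of_wellFoundedLT
    (fun A : Finset (Fin k) => ∃ x ∈ maxFace (polytopeOf a b) u, A = Finset.univ.filter fun j => ⟪x, a j⟫ = b j)
    (hne.elim fun x hx => ⟨_, x, hx, rfl⟩)
  obtain ⟨x, hx, rfl⟩ := hx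
  refine ⟨x, hx, Set.Subset.antisymm (fun z hz p hp => hz p (hp ▸ hx)) fun z hz p hp y hy => ?_⟩
  have hact : ∀ j, ⟪x, a j⟫ = b j → ⟪p, a j⟫ = b j := by
    -- An inequality is tight at the midpoint only if it is tight at both ends, so minimality makes
    -- `p` tight wherever `x` is.
    have hq : (1 / 2 : ℝ) • (x + p) ∈ maxFace (polytopeOf a b) u := by
      refine ⟨fun j => ?_, fun y hy => ?_⟩
      · rw [real_inner_smul_left, inner_add_left]
        linarith [hx.1 j, hp.1 j]
      · rw [inner_smul_right, inner_add_right]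
        linarith [hx.2 y hy, hp.2 y hy]
    intro j hj
    have hsub := hmin ⟨_, hq, rfl⟩ fun j hj => by
      simp only [Finset.mem_filter_univ, real_inner_smul_left, inner_add_left] at hj ⊢
      linarith [hx.1 j, hp.1 j]
    have := hsub (Finset.mem_filter_univ j |>.2 hj)
    simp only [Finset.mem_filter_univ, real_inner_smul_left, inner_add_left] at this
    linarith
  -- The segment from `p` can be prolonged beyond `x`, so a functional maximal at `x` takes the same
  -- value at `p`.
  obtain ⟨ε, hε, H⟩ := mem_polytopeOf_add_smul (y := x - p) hx.1 fun j hj => by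
    rw [inner_sub_left, hj, hact j hj, sub_self]
  have h1 := hz x rfl _ H
  have h2 := hz x rfl y hy
  rw [inner_add_right, inner_smul_right, inner_sub_right] at h1
  nlinarith

theorem mem_posHull {ι : Type*} [Fintype ι] (w : ι → 𝔼 d) (i : ι) : w i ∈ posHull w := by
  classical
  exact ⟨Pi.single i 1, fun j => by by_cases h : j = i <;> simp [h], by simp [Pi.single_apply]⟩

/-- The rays of a simplicial cone of a normal fan are cones of the fan. -/
theorem posHull_singleton_mem_normalFan {P : Set (𝔼 d)} (hP : IsPolyhedron P) {k : ℕ}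
    {w : Fin k → 𝔼 d} (hw : LinearIndependent ℝ w) (hσ : posHull w ∈ normalFan P) (i : Fin k) :
    posHull ![w i] ∈ normalFan P := by
  obtain ⟨K, a, b, rfl⟩ := hP.exists_inner
  rw [mem_normalFan_iff] at hσ ⊢
  obtain ⟨u, hu, hσ⟩ := hσ
  obtain ⟨x, hx, hNx⟩ := exists_normalCone_maxFace_eq hu
  rw [hNx] at hσ
  have hwx : ∀ j, x ∈ maxFace (polytopeOf a b) (w j) := fun j =>
    ⟨hx.1, (hσ ▸ mem_posHull w j : w j ∈ normalCone (polytopeOf a b) {x}) x rfl⟩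
  refine ⟨w i, ⟨x, hwx i⟩, ?_⟩
  -- A step along `y` preserves `w i` and decreases every other generator. It therefore stays on the
  -- face of `w i` and excludes from its normal cone any combination involving another generator.
  obtain ⟨y, hy⟩ := hw.exists_inner_eq fun j => if j = i then 0 else -1
  have hyσ : ∀ c : Fin k → ℝ, ⟪y, ∑ j, c j • w j⟫ = -∑ j ∈ Finset.univ.erase i, c j := by
    intro c
    rw [← Finset.add_sum_erase _ _ (Finset.mem_univ i), inner_add_right, inner_smul_right, hy,
      if_pos rfl, mul_zero, zero_add, inner_sum, ← Finset.sum_neg_distrib]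
    refine Finset.sum_congr rfl fun j hj => ?_
    rw [inner_smul_right, hy, if_neg (Finset.ne_of_mem_erase hj), mul_neg, mul_one]
  obtain ⟨ε, hε, H⟩ := mem_polytopeOf_add_smul (y := y) hx.1 fun j hj => by
    have : a j ∈ posHull w := by
      rw [hσ]
      rintro _ rfl z hz
      rw [real_inner_comm, real_inner_comm _ (a j), hj]
      exact hz j
    obtain ⟨c, hc, hac⟩ := this
    rw [hac, hyσ]
    exact neg_nonpos.2 (Finset.sum_nonneg fun j _ => hc j)
  rw [posHull_singleton]
  refine Set.Subset.antisymm ?_ fun z hz => ?_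
  · rintro _ ⟨c, hc, rfl⟩ p hp z hz
    rw [real_inner_smul_left, real_inner_smul_left]
    exact mul_le_mul_of_nonneg_left (hp.2 z hz) hc
  · have hx' : x + ε • y ∈ maxFace (polytopeOf a b) (w i) := by
      refine ⟨H, fun z hz => ((hwx i).2 z hz).trans ?_⟩
      rw [inner_add_right, inner_smul_right, real_inner_comm _ (w i), real_inner_comm y, hy]
      simp
    have hzσ : z ∈ posHull w := by
      rw [hσ]
      rintro _ rfl
      exact hz _ (hwx i)
    obtain ⟨c, hc, rfl⟩ := hzσ
    have h1 := hz _ hx' x hx.1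
    rw [inner_add_right, inner_smul_right, real_inner_comm y, hyσ] at h1
    have h2 : ∑ j ∈ Finset.univ.erase i, c j = 0 :=
      le_antisymm (by nlinarith) (Finset.sum_nonneg fun j _ => hc j)
    rw [Finset.sum_eq_zero_iff_of_nonneg fun j _ => hc j] at h2
    refine ⟨c i, hc i, ?_⟩
    rw [← Finset.add_sum_erase _ _ (Finset.mem_univ i), Finset.sum_eq_zero, add_zero]
    intro j hj
    rw [h2 j hj, zero_smul]

variable {v : Fin n → 𝔼 d} {P : Set (𝔼 d)}

theorem ne_zero_of_hasRayGenerators (hr : HasRayGenerators (normalFan P) v) (i : Fin n) :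
    v i ≠ 0 := by
  intro h0
  have : posHull ![v i] ∈ {σ ∈ normalFan P | Module.finrank ℝ (Submodule.span ℝ σ) = 1} :=
    hr.2 ▸ ⟨i, rfl⟩
  have h1 := this.2
  rw [posHull_singleton, h0] at h1
  have h2 : Submodule.span ℝ {x : 𝔼 d | ∃ c : ℝ, 0 ≤ c ∧ x = c • (0 : 𝔼 d)} = ⊥ := by
    rw [Submodule.span_eq_bot]
    rintro _ ⟨c, -, rfl⟩
    exact smul_zero c
  rw [h2, finrank_bot] at h1
  exact zero_ne_one h1

theorem posHull_smul {w : 𝔼 d} {c : ℝ} (hc : 0 < c) : posHull ![c • w] = posHull ![w] := by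
  rw [posHull_singleton, posHull_singleton]
  ext x
  constructor
  · rintro ⟨b, hb, rfl⟩
    exact ⟨b * c, by positivity, by rw [mul_smul]⟩
  · rintro ⟨b, hb, rfl⟩
    exact ⟨b / c, by positivity, by rw [smul_smul, div_mul_cancel₀ _ hc.ne']⟩

/-- Every cone of a simplicial normal fan is generated by ray generators. -/
theorem exists_eq_posHull (hP : IsPolyhedron P) (hs : ∀ σ ∈ normalFan P, IsSimplicialCone σ)
    (hr : HasRayGenerators (normalFan P) v) {σ : Set (𝔼 d)} (hσ : σ ∈ normalFan P) :
    ∃ (k : ℕ) (t : Fin k → Fin n), LinearIndependent ℝ (v ∘ t) ∧ σ = posHull (v ∘ t) := by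
  obtain ⟨k, w, hw, rfl⟩ := hs σ hσ
  have key : ∀ i, ∃ j, ∃ c : ℝ, 0 < c ∧ w i = c • v j := by
    intro i
    have h1 := posHull_singleton_mem_normalFan hP hw hσ i
    have h2 : Submodule.span ℝ (posHull ![w i]) = Submodule.span ℝ {w i} := by
      refine le_antisymm (Submodule.span_le.2 ?_) (Submodule.span_le.2 ?_)
      · rw [posHull_singleton]
        rintro _ ⟨c, -, rfl⟩
        exact Submodule.smul_mem _ _ (Submodule.mem_span_singleton_self _)
      · rw [posHull_singleton, Set.singleton_subset_iff]
        exact Submodule.subset_span ⟨1, zero_le_one, (one_smul _ _).symm⟩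
    have h3 : posHull ![w i] ∈ Set.range fun i => posHull ![v i] := by
      rw [← hr.2]
      refine ⟨h1, ?_⟩
      rw [h2, finrank_span_singleton (hw.ne_zero i)]
    obtain ⟨j, hj⟩ := h3
    have h4 : w i ∈ posHull ![v j] := by
      simp only at hj
      rw [hj, posHull_singleton]
      exact ⟨1, zero_le_one, (one_smul _ _).symm⟩
    rw [posHull_singleton] at h4
    obtain ⟨c, hc, h5⟩ := h4
    refine ⟨j, c, lt_of_le_of_ne hc ?_, h5⟩
    rintro rfl
    exact hw.ne_zero i (by simpa using h5)
  choose t c hc hwt using key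
  have hwv : w = fun i => c i • v (t i) := funext hwt
  refine ⟨k, t, ?_, ?_⟩
  · have : v ∘ t = fun i => (Units.mk0 (c i) (hc i).ne')⁻¹ • w i := by
      funext i
      rw [hwt i, Units.smul_def, smul_smul]
      simp [(hc i).ne']
    rw [this]
    exact hw.units_smul _
  · rw [hwv]
    ext x
    constructor
    · rintro ⟨b, hb, rfl⟩
      exact ⟨fun i => b i * c i, fun i => mul_nonneg (hb i) (hc i).le, by simp [mul_smul]⟩
    · rintro ⟨b, hb, rfl⟩
      refine ⟨fun i => b i / c i, fun i => div_nonneg (hb i) (hc i).le, ?_⟩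
      refine Finset.sum_congr rfl fun i _ => ?_
      rw [smul_smul, div_mul_cancel₀ _ (hc i).ne', Function.comp_apply]

/-- The ray is the normal cone of some face, and `v i` is maximal on that face. So the face of `v i`
contains it and has a smaller or equal normal cone, which still contains the ray. -/
theorem normalCone_maxFace_generator (hr : HasRayGenerators (normalFan P) v) (i : Fin n) :
    (maxFace P (v i)).Nonempty ∧ normalCone P (maxFace P (v i)) = posHull ![v i] := by
  have : posHull ![v i] ∈ {σ ∈ normalFan P | Module.finrank ℝ (Submodule.span ℝ σ) = 1} :=
    hr.2 ▸ ⟨i, rfl⟩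
  obtain ⟨u, hu, hN⟩ := mem_normalFan_iff.1 this.1
  have hvi : v i ∈ normalCone P (maxFace P u) := by
    rw [← hN, posHull_singleton]
    exact ⟨1, zero_le_one, (one_smul _ _).symm⟩
  have hsub : maxFace P u ⊆ maxFace P (v i) := fun p hp => ⟨hp.1, hvi p hp⟩
  refine ⟨hu.mono hsub, Set.Subset.antisymm (fun z hz => ?_) ?_⟩
  · rw [hN]
    exact fun p hp => hz p (hsub hp)
  · rw [posHull_singleton]
    rintro _ ⟨c, hc, rfl⟩ p hp z hz
    rw [real_inner_smul_left, real_inner_smul_left]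
    exact mul_le_mul_of_nonneg_left (hp.2 z hz) hc

/-- The inclusion of `P` in `P(h)` makes `P` compact, so each facet normal `a l` attains its maximum
at some `p`. It is a nonnegative combination of vectors `v i` also maximal at `p`, so the
inequalities of `V` imply the one for `a l`. -/
theorem eq_polytopeOf_supportFun (hv : PositivelySpanning v) (hP : IsPolyhedron P)
    (hne : P.Nonempty) (hs : ∀ σ ∈ normalFan P, IsSimplicialCone σ)
    (hr : HasRayGenerators (normalFan P) v) :
    P = polytopeOf v (fun i => supportFun P (v i)) := by
  have hle : P ⊆ polytopeOf v (fun i => supportFun P (v i)) := by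
    intro x hx i
    obtain ⟨p, hp⟩ := (normalCone_maxFace_generator hr i).1
    simp only
    rw [supportFun_eq hp, real_inner_comm]
    exact hp.2 x hx
  refine hle.antisymm fun x hx => ?_
  have hc : IsCompact P := by
    obtain ⟨k, a, b, rfl⟩ := hP.exists_inner
    exact (polytopeOf_isCompact hv _).of_isClosed_subset (polytopeOf_isClosed a b) hle
  obtain ⟨k, a, b, hPab⟩ := hP.exists_inner
  rw [hPab]
  intro l
  obtain ⟨p, hp⟩ := maxFace_nonempty hc hne (a l)
  obtain ⟨k, t, -, ht⟩ := exists_eq_posHull hP hs hr (mem_normalFan_iff.2 ⟨a l, ⟨p, hp⟩, rfl⟩)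
  obtain ⟨c, hc, hac⟩ : a l ∈ posHull (v ∘ t) := ht ▸ mem_normalCone_maxFace P (a l)
  have htp : ∀ i, p ∈ maxFace P (v (t i)) := fun i => by
    refine ⟨hp.1, ?_⟩
    have : v (t i) ∈ normalCone P (maxFace P (a l)) := by
      rw [ht]
      exact mem_posHull (v ∘ t) i
    exact this p hp
  have hpb : ⟪p, a l⟫ ≤ b l := (hPab ▸ hp.1 : p ∈ polytopeOf a b) l
  refine le_trans ?_ hpb
  rw [hac]
  simp only [inner_sum, inner_smul_right, Function.comp_apply]
  refine Finset.sum_le_sum fun i _ => mul_le_mul_of_nonneg_left ?_ (hc i)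
  refine (hx (t i)).trans ?_
  simp only
  rw [supportFun_eq (htp i), real_inner_comm]

/-- The normal cone at a vertex has linearly independent generators `v (t s)`. Every tight `v j`
turns out to be one of them, so the tight normals are independent; those in `I` already span, which
leaves no room for another. -/
theorem isSimple_of_hasRayGenerators (hv : PositivelySpanning v) (hP : IsPolyhedron P)
    (hne : P.Nonempty) (hs : ∀ σ ∈ normalFan P, IsSimplicialCone σ)
    (hr : HasRayGenerators (normalFan P) v) : IsSimple v (fun i => supportFun P (v i)) := by
  have hPeq := eq_polytopeOf_supportFun hv hP hne hs hr
  set h : Fin n → ℝ := fun i => supportFun P (v i) with hdef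
  have htight : ∀ j, ∀ x ∈ maxFace P (v j), ⟪x, v j⟫ = h j := fun j x hx => by
    rw [hdef]
    simp only
    rw [supportFun_eq hx, real_inner_comm]
  have hmax : ∀ j, ∀ x ∈ P, ⟪x, v j⟫ = h j → x ∈ maxFace P (v j) := fun j x hx hxj => by
    refine ⟨hx, fun y hy => ?_⟩
    rw [real_inner_comm, real_inner_comm x, hxj]
    exact (hPeq ▸ hy : y ∈ polytopeOf v h) j
  have hnd : IsNondegenerate v h := by
    intro I hI j hj
    have hxP : vertex v I h ∈ P := hPeq ▸ hI.2
    set x := vertex v I h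
    have hF : maxFace P (∑ i ∈ I, (1 : ℝ) • v i) = {x} := by
      refine Set.Subset.antisymm (fun y hy => ?_) ?_
      · rw [hPeq] at hy
        exact hI.1.eq_vertex (tight_of_mem_maxFace hI subset_rfl (fun _ _ => one_pos) hy)
      · rintro _ rfl
        have := mem_maxFace_of_tight (c := 1) (fun _ _ => zero_le_one) hI.2
          fun i hi => hI.1.inner_vertex_of_mem h hi
        rw [hPeq]
        exact this
    obtain ⟨k, t, hli, ht⟩ := exists_eq_posHull hP hs hr (mem_normalFan_iff.2
      ⟨∑ i ∈ I, (1 : ℝ) • v i, hF ▸ Set.singleton_nonempty x, rfl⟩)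
    rw [hF] at ht
    have hact : ∀ j, ⟪x, v j⟫ = h j → j ∈ Set.range t := by
      intro j hj
      have hxj := hmax j x hxP hj
      have h1 : v j ∈ normalCone P {x} := by
        rintro _ rfl
        exact hxj.2
      rw [ht] at h1
      obtain ⟨c, hc, hjc⟩ := h1
      -- A generator used in the expansion of `v j` is maximal on the whole face of `v j`, whose
      -- normal cone is just the ray of `v j`. So the two rays coincide.
      obtain ⟨s, hs⟩ : ∃ s, c s ≠ 0 := by
        by_contra! h0
        exact ne_zero_of_hasRayGenerators hr j (by simp [hjc, h0])
      have hts : ∀ s, x ∈ maxFace P (v (t s)) := fun s => by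
        refine ⟨hxP, ?_⟩
        have : v (t s) ∈ normalCone P {x} := by
          rw [ht]
          exact mem_posHull (v ∘ t) s
        exact this x rfl
      have h2 : v (t s) ∈ normalCone P (maxFace P (v j)) := by
        intro p hp y hy
        have h3 : ∑ s, c s * (⟪v (t s), x⟫ - ⟪v (t s), p⟫) = ⟪v j, x⟫ - ⟪v j, p⟫ := by
          rw [hjc]
          simp [sum_inner, real_inner_smul_left, mul_sub]
        have h4 : ∑ s, c s * (⟪v (t s), x⟫ - ⟪v (t s), p⟫) = 0 := by
          refine le_antisymm (h3 ▸ sub_nonpos.2 (hp.2 x hxP)) ?_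
          exact Finset.sum_nonneg fun s _ => mul_nonneg (hc s) (sub_nonneg.2 ((hts s).2 p hp.1))
        rw [Finset.sum_eq_zero_iff_of_nonneg fun s _ =>
          mul_nonneg (hc s) (sub_nonneg.2 ((hts s).2 p hp.1))] at h4
        have h5 := (mul_eq_zero.1 (h4 s (Finset.mem_univ s))).resolve_left hs
        exact ((hts s).2 y hy).trans (sub_eq_zero.1 h5).le
      rw [(normalCone_maxFace_generator hr j).2, posHull_singleton] at h2
      obtain ⟨b, hb, h6⟩ := h2
      have hb0 : 0 < b := lt_of_le_of_ne hb (by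
        rintro rfl
        exact ne_zero_of_hasRayGenerators hr (t s) (by simpa using h6))
      refine ⟨s, hr.1 ?_⟩
      simp only
      rw [h6, posHull_smul hb0]
    by_contra hjI
    obtain ⟨s, rfl⟩ := hact j hj
    have h7 : v (t s) ∉ Submodule.span ℝ ((v ∘ t) '' {r | t r ∈ I}) := by
      have := hli.notMem_span_image (s := {r | t r ∈ I}) (x := s) hjI
      exact this
    apply h7
    rw [hI.1.sum_dualVec (v (t s))]
    refine Submodule.sum_mem _ fun i hi => Submodule.smul_mem _ _ ?_
    obtain ⟨r, rfl⟩ := hact i (hI.1.inner_vertex_of_mem h hi)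
    exact Submodule.subset_span ⟨r, hi, rfl⟩
  have hne' : (polytopeOf v h).Nonempty := hPeq ▸ hne
  refine ⟨hne', hnd, fun j => ?_⟩
  obtain ⟨I, hI, hIj⟩ := exists_vertex_mem_maxFace hv hne' (v j)
  exact ⟨I, hI, hnd I hI j (htight j _ (by rw [hPeq]; exact hIj))⟩

/-! ### Type cones and deformation cones by linear inequalities. -/

/-- `h ↦ ⟪vertex v I h, v j⟫ - h j` as a linear functional. -/
def vertexGap (v : Fin n → 𝔼 d) (I : Finset (Fin n)) (j : Fin n) : Module.Dual ℝ (Fin n → ℝ) :=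
  ∑ i ∈ I, ⟪dualVec v I i, v j⟫ • (LinearMap.proj i : Module.Dual ℝ (Fin n → ℝ)) -
    LinearMap.proj j

theorem vertexGap_apply (v : Fin n → 𝔼 d) (I : Finset (Fin n)) (j : Fin n) (h : Fin n → ℝ) :
    vertexGap v I j h = ⟪vertex v I h, v j⟫ - h j := by
  simp [vertexGap, inner_vertex]

/-- The heights `h` for which all the vertices indexed by `𝒯` lie in `P(h)` and no further
inequality is tight there. -/
def strictCone (v : Fin n → 𝔼 d) (𝒯 : Set (Finset (Fin n))) : Set (Fin n → ℝ) :=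
  {h | ∀ I ∈ 𝒯, ∀ j, j ∉ I → ⟪vertex v I h, v j⟫ < h j}

/-- The heights `h` for which all the vertices indexed by `𝒯` lie in `P(h)`. -/
def weakCone (v : Fin n → 𝔼 d) (𝒯 : Set (Finset (Fin n))) : Set (Fin n → ℝ) :=
  {h | ∀ I ∈ 𝒯, vertex v I h ∈ polytopeOf v h}

variable {𝒯 : Set (Finset (Fin n))}

theorem isPolyhedralCone_weakCone (v : Fin n → 𝔼 d) (𝒯 : Set (Finset (Fin n))) :
    IsPolyhedralCone (weakCone v 𝒯) := by
  classical
  let e := (Finite.equivFin (𝒯 × Fin n))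
  refine ⟨_, fun k => vertexGap v (e.symm k).1 (e.symm k).2, ?_⟩
  ext h
  simp only [Set.mem_ofPred_eq, vertexGap_apply, sub_nonpos]
  exact ⟨fun hh k => hh _ (e.symm k).1.2 _, fun hh I hI j => by simpa using hh (e (⟨I, hI⟩, j))⟩

theorem isClosed_weakCone (v : Fin n → 𝔼 d) (𝒯 : Set (Finset (Fin n))) :
    IsClosed (weakCone v 𝒯) := by
  have : weakCone v 𝒯 = {h | ∀ I ∈ 𝒯, ∀ j, ⟪vertex v I h, v j⟫ ≤ h j} := rfl
  simp only [this, Set.ofPred_forall]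
  refine isClosed_iInter fun I => isClosed_iInter fun _ => isClosed_iInter fun j => ?_
  have := continuous_vertex v I
  exact isClosed_le (by fun_prop) (by fun_prop)

theorem isOpen_strictCone (v : Fin n → 𝔼 d) (𝒯 : Set (Finset (Fin n))) :
    IsOpen (strictCone v 𝒯) := by
  simp only [strictCone, Set.ofPred_forall]
  refine isOpen_iInter_of_finite fun I => isOpen_iInter_of_finite fun _ =>
    isOpen_iInter_of_finite fun j => isOpen_iInter_of_finite fun _ => ?_
  have := continuous_vertex v I
  exact isOpen_lt (by fun_prop) (by fun_prop)

theorem strictCone_subset_weakCone (h𝒯 : ∀ I ∈ 𝒯, IsBasisSet v I) :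
    strictCone v 𝒯 ⊆ weakCone v 𝒯 := by
  intro h hh I hI j
  by_cases hj : j ∈ I
  · exact ((h𝒯 I hI).inner_vertex_of_mem h hj).le
  · exact (hh I hI j hj).le

/-- Adding a small positive multiple of a strict point makes all weak inequalities strict. -/
theorem closure_strictCone (h𝒯 : ∀ I ∈ 𝒯, IsBasisSet v I) (hne : (strictCone v 𝒯).Nonempty) :
    closure (strictCone v 𝒯) = weakCone v 𝒯 := by
  refine Set.Subset.antisymm
    (closure_minimal (strictCone_subset_weakCone h𝒯) (isClosed_weakCone v 𝒯)) fun h hh => ?_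
  obtain ⟨h0, hh0⟩ := hne
  have hlim : Filter.Tendsto (fun ε : ℝ => h + ε • h0) (nhdsWithin 0 (Set.Ioi 0)) (nhds h) := by
    have : Filter.Tendsto (fun ε : ℝ => h + ε • h0) (nhds 0) (nhds (h + (0 : ℝ) • h0)) :=
      Continuous.tendsto (by fun_prop) 0
    rw [zero_smul, add_zero] at this
    exact this.mono_left nhdsWithin_le_nhds
  refine mem_closure_of_tendsto hlim ?_
  filter_upwards [self_mem_nhdsWithin] with ε hε I hI j hj
  have h1 := hh I hI j
  have h2 := mul_lt_mul_of_pos_left (hh0 I hI j hj) (Set.mem_Ioi.1 hε)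
  have h3 := vertexGap_apply v I j (h + ε • h0)
  rw [map_add, map_smul, vertexGap_apply, vertexGap_apply, smul_eq_mul] at h3
  simp only [Pi.add_apply, Pi.smul_apply, smul_eq_mul] at h3 ⊢
  linarith

theorem vertexSets_subset_of_mem_weakCone {h h₀ : Fin n → ℝ}
    (hh : h ∈ weakCone v (vertexSets v h₀)) : vertexSets v h₀ ⊆ vertexSets v h :=
  fun I hI => ⟨hI.1, hh I hI⟩

namespace IsSimple

variable {h h₀ : Fin n → ℝ}

theorem mem_strictCone (hh : IsSimple v h) : h ∈ strictCone v (vertexSets v h) :=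
  fun I hI j hj => lt_of_le_of_ne (hI.2 j) fun e => hj (hh.nondegenerate I hI j e)

theorem exists_mem_faceCone (hv : PositivelySpanning v) (hh : IsSimple v h) (u : 𝔼 d) :
    ∃ I ∈ vertexSets v h, u ∈ faceCone v I :=
  hh.nondegenerate.exists_mem_faceCone hv hh.nonempty u

/-- The cones of `h₀` cover the space, so for a basis `I` of `h` the vector `∑ i ∈ I, v i` lies in
the cone over some `I'`. The vertex of `I'` is then tight on `I`, and strictness forces `I ⊆ I'`. -/
theorem vertexSets_eq_of_mem_strictCone (hv : PositivelySpanning v) (h₀s : IsSimple v h₀)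
    (hh : h ∈ strictCone v (vertexSets v h₀)) : vertexSets v h = vertexSets v h₀ := by
  have hw := strictCone_subset_weakCone (fun I hI => hI.1) hh
  refine Set.Subset.antisymm (fun I hI => ?_) fun I hI => vertexSets_subset_of_mem_weakCone hw hI
  obtain ⟨I', hI', hu⟩ := h₀s.exists_mem_faceCone hv (∑ i ∈ I, (1 : ℝ) • v i)
  have h1 := vertex_mem_maxFace (vertexSets_subset_of_mem_weakCone hw hI') subset_rfl hu
  have h2 := tight_of_mem_maxFace hI subset_rfl (fun _ _ => one_pos) h1
  have h3 : I ⊆ I' := fun i hi => by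
    by_contra hi'
    exact (hh I' hI' i hi').ne (h2 i hi)
  rwa [hI.1.eq_of_subset hI'.1 h3]

theorem of_mem_strictCone (hv : PositivelySpanning v) (h₀s : IsSimple v h₀)
    (hh : h ∈ strictCone v (vertexSets v h₀)) : IsSimple v h := by
  have heq := h₀s.vertexSets_eq_of_mem_strictCone hv hh
  obtain ⟨I, hI, -⟩ := h₀s.exists_mem_faceCone hv 0
  refine ⟨⟨_, (heq ▸ hI : I ∈ vertexSets v h).2⟩, fun I hI j hj => ?_, heq ▸ h₀s.exists_mem⟩
  by_contra hjI
  exact (hh I (heq ▸ hI) j hjI).ne hj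

theorem typeCone_eq (hv : PositivelySpanning v) (h₀s : IsSimple v h₀) :
    typeCone (normalFan (polytopeOf v h₀)) v = strictCone v (vertexSets v h₀) := by
  ext h
  constructor
  · rintro ⟨P, hP, hne, hΔ, rfl⟩
    have hmem := h₀s.normalFan_mem hv
    rw [← hΔ] at hmem
    have hs := isSimple_of_hasRayGenerators hv hP.1 hne hmem.2.1 hmem.2.2
    have hPeq := eq_polytopeOf_supportFun hv hP.1 hne hmem.2.1 hmem.2.2
    rw [h₀s.vertexSets_eq hv hs (by rw [← hPeq, hΔ])]
    exact hs.mem_strictCone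
  · intro hh
    have hs := h₀s.of_mem_strictCone hv hh
    have heq : normalFan (polytopeOf v h) = normalFan (polytopeOf v h₀) := by
      rw [normalFan_eq hv hs.nonempty hs.nondegenerate,
        normalFan_eq hv h₀s.nonempty h₀s.nondegenerate, h₀s.vertexSets_eq_of_mem_strictCone hv hh]
    exact heq ▸ hs.mem_typeCone hv

theorem deformationCone_eq (hv : PositivelySpanning v) (h₀s : IsSimple v h₀) :
    deformationCone (normalFan (polytopeOf v h₀)) v = weakCone v (vertexSets v h₀) := by
  rw [deformationCone, h₀s.typeCone_eq hv,
    closure_strictCone (fun I hI => hI.1) ⟨h₀, h₀s.mem_strictCone⟩]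

/-- From a vertex tight at `i`, a short step along `dualVec v I i` violates only inequality `i`. -/
theorem mem_irSet (hh : IsSimple v h) : h ∈ irSet v := by
  refine ⟨hh.nonempty, fun i heq => ?_⟩
  obtain ⟨I, hI, hi⟩ := hh.exists_mem i
  obtain ⟨ε, hε, H⟩ := exists_pos_add_mul_le (ι := {j // j ≠ i})
    (s := fun j => ⟪vertex v I h, v j⟫) (t := fun j => ⟪dualVec v I i, v j⟫) (b := fun j => h j)
    (fun j => hI.2 j) fun j hj => by
      rw [hI.1.inner_dualVec hi (hh.nondegenerate I hI j hj), if_neg j.2.symm]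
  have hmem : vertex v I h + ε • dualVec v I i ∈ polytopeOf v h := by
    rw [← heq]
    intro j hj
    rw [inner_add_left, real_inner_smul_left]
    exact H ⟨j, hj⟩
  have h1 := hmem i
  rw [inner_add_left, real_inner_smul_left, hI.1.inner_dualVec hi hi, if_pos rfl,
    hI.1.inner_vertex_of_mem h hi] at h1
  linarith

end IsSimple

theorem exists_isSimple_of_mem (hv : PositivelySpanning v) {Δ : Set (Set (𝔼 d))}
    (hΔ : Δ ∈ simplicialPolytopalFans v) :
    ∃ h, IsSimple v h ∧ Δ = normalFan (polytopeOf v h) := by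
  obtain ⟨⟨P, hP, hne, rfl⟩, hs, hr⟩ := hΔ
  exact ⟨_, isSimple_of_hasRayGenerators hv hP hne hs hr,
    congrArg normalFan (eq_polytopeOf_supportFun hv hP hne hs hr)⟩

theorem mem_deformationCones_iff (hv : PositivelySpanning v) {C : Set (Fin n → ℝ)} :
    C ∈ deformationCones v ↔ ∃ h, IsSimple v h ∧ C = weakCone v (vertexSets v h) := by
  constructor
  · rintro ⟨Δ, hΔ, rfl⟩
    obtain ⟨h, hh, rfl⟩ := exists_isSimple_of_mem hv hΔ
    exact ⟨h, hh, hh.deformationCone_eq hv⟩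
  · rintro ⟨h, hh, rfl⟩
    exact ⟨_, hh.normalFan_mem hv, hh.deformationCone_eq hv⟩

theorem finite_deformationCones (hv : PositivelySpanning v) : (deformationCones v).Finite := by
  refine (Set.finite_range (weakCone v)).subset fun C hC => ?_
  obtain ⟨h, -, rfl⟩ := (mem_deformationCones_iff hv).1 hC
  exact ⟨_, rfl⟩

/-! ### Density of simple heights and the covering of `clir(V)`. -/

theorem isSimple_of_mem_irSet (hv : PositivelySpanning v) {h : Fin n → ℝ} (hh : h ∈ irSet v)
    (hnd : IsNondegenerate v h) : IsSimple v h := by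
  refine ⟨hh.1, hnd, fun i => ?_⟩
  obtain ⟨x₀, hx₀⟩ := hh.1
  obtain ⟨x, hx, hxP⟩ : ∃ x, (∀ j, j ≠ i → ⟪x, v j⟫ ≤ h j) ∧ x ∉ polytopeOf v h := by
    by_contra! hcon
    exact hh.2 i (Set.Subset.antisymm hcon fun x hx j _ => hx j)
  have hxi : h i < ⟪x, v i⟫ := by
    by_contra! hle
    exact hxP fun j => by
      by_cases hj : j = i
      · exact hj ▸ hle
      · exact hx j hj
  -- The segment from the feasible `x₀` to `x`, which violates only inequality `i`, meets the
  -- hyperplane of `i` at parameter `r`. That point lies in `P(h)`, so inequality `i` is tight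
  -- somewhere, hence at a vertex.
  set r := (h i - ⟪x₀, v i⟫) / (⟪x, v i⟫ - ⟪x₀, v i⟫) with hr
  have hden : 0 < ⟪x, v i⟫ - ⟪x₀, v i⟫ := by linarith [hx₀ i]
  have hr0 : 0 ≤ r := div_nonneg (sub_nonneg.2 (hx₀ i)) hden.le
  have hr1 : r ≤ 1 := (div_le_one hden).2 (by linarith)
  have hri : r * (⟪x, v i⟫ - ⟪x₀, v i⟫) = h i - ⟪x₀, v i⟫ := div_mul_cancel₀ _ hden.ne'
  have hz : ∀ j, ⟪(1 - r) • x₀ + r • x, v j⟫ = (1 - r) * ⟪x₀, v j⟫ + r * ⟪x, v j⟫ := fun j => by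
    rw [inner_add_left, real_inner_smul_left, real_inner_smul_left]
  have hzi : ⟪(1 - r) • x₀ + r • x, v i⟫ = h i := by rw [hz]; linarith
  have hzP : (1 - r) • x₀ + r • x ∈ polytopeOf v h := by
    intro j
    by_cases hj : j = i
    · rw [hj, hzi]
    · rw [hz]
      nlinarith [mul_le_mul_of_nonneg_left (hx₀ j) (sub_nonneg.2 hr1),
        mul_le_mul_of_nonneg_left (hx j hj) hr0]
  obtain ⟨I, hI, hIi⟩ := exists_vertex_mem_maxFace hv hh.1 (v i)
  refine ⟨I, hI, hnd I hI i (le_antisymm (hI.2 i) ?_)⟩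
  have := hIi.2 _ hzP
  rwa [real_inner_comm, hzi, real_inner_comm] at this

/-- The heights whose polytopes have nonempty interior and strictly irredundant inequalities. -/
def strictIrSet (v : Fin n → 𝔼 d) : Set (Fin n → ℝ) :=
  {h | (∃ x : 𝔼 d, ∀ j, ⟪x, v j⟫ < h j) ∧
    ∀ i, ∃ x : 𝔼 d, (∀ j, j ≠ i → ⟪x, v j⟫ < h j) ∧ h i < ⟪x, v i⟫}

theorem isOpen_strictIrSet (v : Fin n → 𝔼 d) : IsOpen (strictIrSet v) := by
  simp only [strictIrSet, Set.ofPred_and, Set.ofPred_forall, Set.ofPred_exists]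
  refine (isOpen_iUnion fun x => isOpen_iInter_of_finite fun j => ?_).inter
    (isOpen_iInter_of_finite fun i => isOpen_iUnion fun x =>
      (isOpen_iInter_of_finite fun j => isOpen_iInter_of_finite fun _ => ?_).inter ?_)
  · exact isOpen_lt continuous_const (continuous_apply j)
  · exact isOpen_lt continuous_const (continuous_apply j)
  · exact isOpen_lt (continuous_apply i) continuous_const

theorem strictIrSet_subset_irSet (v : Fin n → 𝔼 d) : strictIrSet v ⊆ irSet v := by
  rintro h ⟨⟨x, hx⟩, hi⟩
  refine ⟨⟨x, fun j => (hx j).le⟩, fun i heq => ?_⟩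
  obtain ⟨y, hy, hyi⟩ := hi i
  have : y ∈ polytopeOf v h := heq ▸ fun j hj => (hy j hj).le
  exact (this i).not_gt hyi

/-- Raising all heights by a small `ε` makes the weak inequalities strict and keeps the finitely
many strict violations. -/
theorem irSet_subset_closure_strictIrSet (v : Fin n → 𝔼 d) :
    irSet v ⊆ closure (strictIrSet v) := by
  rintro h ⟨⟨x₀, hx₀⟩, hi⟩
  have hx : ∀ i, ∃ x : 𝔼 d, (∀ j, j ≠ i → ⟪x, v j⟫ ≤ h j) ∧ h i < ⟪x, v i⟫ := by
    intro i
    by_contra! hcon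
    refine hi i (Set.Subset.antisymm (fun x hx j => ?_) fun x hx j _ => hx j)
    by_cases hj : j = i
    · exact hj ▸ hcon x hx
    · exact hx j hj
  choose x hx hxi using hx
  have hlim : Filter.Tendsto (fun (ε : ℝ) (j : Fin n) => h j + ε) (nhdsWithin 0 (Set.Ioi 0))
      (nhds h) := by
    have : Filter.Tendsto (fun (ε : ℝ) (j : Fin n) => h j + ε) (nhds 0)
        (nhds fun j => h j + 0) := Continuous.tendsto (by fun_prop) 0
    simp only [add_zero] at this
    exact this.mono_left nhdsWithin_le_nhds
  refine mem_closure_of_tendsto hlim ?_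
  have hev : ∀ᶠ ε in nhdsWithin (0 : ℝ) (Set.Ioi 0), ∀ i, h i + ε < ⟪x i, v i⟫ :=
    Filter.eventually_all.2 fun i =>
      ((tendsto_pi_nhds.1 hlim i).eventually (gt_mem_nhds (hxi i)))
  filter_upwards [self_mem_nhdsWithin, hev] with ε hε hε'
  have hε : 0 < ε := hε
  exact ⟨⟨x₀, fun j => by linarith [hx₀ j]⟩, fun i => ⟨x i, fun j hj => by
    linarith [hx i j hj], hε' i⟩⟩

/-- Since `j ∉ I`, the vertex does not depend on `h j`, so raising `h j` changes the gap at rate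
`-1`. -/
theorem dense_setOf_vertexGap_ne (I : Finset (Fin n)) {j : Fin n} (hj : j ∉ I) :
    Dense {h : Fin n → ℝ | vertexGap v I j h ≠ 0} := by
  intro h
  by_cases h0 : vertexGap v I j h = 0
  · have hlim : Filter.Tendsto (fun ε : ℝ => h + ε • (Pi.single j 1 : Fin n → ℝ))
        (nhdsWithin 0 (Set.Ioi 0)) (nhds h) := by
      have : Filter.Tendsto (fun ε : ℝ => h + ε • (Pi.single j 1 : Fin n → ℝ)) (nhds 0)
          (nhds (h + (0 : ℝ) • Pi.single j 1)) := Continuous.tendsto (by fun_prop) 0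
      rw [zero_smul, add_zero] at this
      exact this.mono_left nhdsWithin_le_nhds
    refine mem_closure_of_tendsto hlim ?_
    filter_upwards [self_mem_nhdsWithin] with ε hε
    have h1 : vertexGap v I j (Pi.single j 1) = -1 := by
      have : ∑ i ∈ I, ⟪dualVec v I i, v j⟫ * (Pi.single j 1 : Fin n → ℝ) i = 0 :=
        Finset.sum_eq_zero fun i hi => by
          rw [Pi.single_eq_of_ne (by rintro rfl; exact hj hi), mul_zero]
      rw [vertexGap_apply, inner_vertex, this]
      simp
    change vertexGap v I j _ ≠ 0
    rw [map_add, map_smul, h0, h1]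
    simpa using (Set.mem_Ioi.1 hε).ne'
  · exact subset_closure h0

theorem dense_isNondegenerate (v : Fin n → 𝔼 d) : Dense {h | IsNondegenerate v h} := by
  -- Index sets that are not bases are harmless here: their dual vectors default to `0`, and the gap
  -- still has coefficient `-1` at `j`.
  have : Dense (⋂ p : {p : Finset (Fin n) × Fin n // p.2 ∉ p.1},
      {h : Fin n → ℝ | vertexGap v p.1.1 p.1.2 h ≠ 0}) := by
    refine dense_iInter_of_isOpen (fun p => ?_) fun p => dense_setOf_vertexGap_ne _ p.2
    exact isOpen_ne_fun (LinearMap.continuous_of_finiteDimensional _) continuous_const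
  refine this.mono fun h hh I _ j hj => ?_
  by_contra hjI
  refine Set.mem_iInter.1 hh ⟨(I, j), hjI⟩ ?_
  rw [vertexGap_apply, hj, sub_self]

theorem closure_isSimple (hv : PositivelySpanning v) : closure {h | IsSimple v h} = clir v := by
  refine Set.Subset.antisymm (closure_mono fun h hh => IsSimple.mem_irSet hh) ?_
  refine closure_minimal ((irSet_subset_closure_strictIrSet v).trans ?_) isClosed_closure
  refine closure_minimal ?_ isClosed_closure
  refine ((dense_isNondegenerate v).open_subset_closure_inter (isOpen_strictIrSet v)).trans
    (closure_mono ?_)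
  exact fun h hh => isSimple_of_mem_irSet hv (strictIrSet_subset_irSet v hh.1) hh.2

theorem sUnion_deformationCones (hv : PositivelySpanning v) : ⋃₀ deformationCones v = clir v := by
  rw [← closure_isSimple hv]
  refine Set.Subset.antisymm (Set.sUnion_subset fun C hC => ?_)
    (closure_minimal (fun h hh => ?_) ?_)
  · obtain ⟨h, hh, rfl⟩ := (mem_deformationCones_iff hv).1 hC
    rw [← closure_strictCone (fun I hI => hI.1) ⟨h, hh.mem_strictCone⟩]
    exact closure_mono fun h' hh' => hh.of_mem_strictCone hv hh'
  · exact ⟨_, (mem_deformationCones_iff hv).2 ⟨h, hh, rfl⟩, fun I hI => hI.2⟩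
  · rw [Set.sUnion_eq_biUnion]
    refine Set.Finite.isClosed_biUnion (finite_deformationCones hv) fun C hC => ?_
    obtain ⟨h, -, rfl⟩ := (mem_deformationCones_iff hv).1 hC
    exact isClosed_weakCone _ _

/-! ### Linearity of support functions and common faces. -/

theorem zero_mem_weakCone (v : Fin n → 𝔼 d) (𝒯 : Set (Finset (Fin n))) :
    (0 : Fin n → ℝ) ∈ weakCone v 𝒯 := by
  intro I _ j
  simp [vertex]

theorem supportFun_eq_inner_vertex {h₀ h : Fin n → ℝ}
    (hh : h ∈ weakCone v (vertexSets v h₀)) {I : Finset (Fin n)} (hI : I ∈ vertexSets v h₀)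
    {u : 𝔼 d} (hu : u ∈ faceCone v I) :
    supportFun (polytopeOf v h) u = ∑ i ∈ I, ⟪dualVec v I i, u⟫ * h i := by
  rw [supportFun_eq (vertex_mem_maxFace (vertexSets_subset_of_mem_weakCone hh hI) subset_rfl hu),
    real_inner_comm, inner_vertex]

/-- Support functions evaluate linearly on a deformation cone. -/
theorem IsSimple.exists_matrix (hv : PositivelySpanning v) {h₀ : Fin n → ℝ}
    (h₀s : IsSimple v h₀) (u : Fin m → 𝔼 d) :
    ∃ A : Matrix (Fin m) (Fin n) ℝ, ∀ h ∈ weakCone v (vertexSets v h₀), ∀ i,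
      supportFun (polytopeOf v h) (u i) = A.mulVec h i := by
  classical
  choose I hI hu using fun i => h₀s.exists_mem_faceCone hv (u i)
  refine ⟨fun i k => if k ∈ I i then ⟪dualVec v (I i) k, u i⟫ else 0, fun h hh i => ?_⟩
  rw [supportFun_eq_inner_vertex hh (hI i) (hu i)]
  simp [Matrix.mulVec, dotProduct, ite_mul, Finset.sum_ite_mem]

theorem isExposed_weakCone_inter (hv : PositivelySpanning v) {h₁ h₂ : Fin n → ℝ}
    (hs₁ : IsSimple v h₁) :
    IsExposed ℝ (weakCone v (vertexSets v h₁))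
      (weakCone v (vertexSets v h₁) ∩ weakCone v (vertexSets v h₂)) := by
  classical
  intro _
  obtain ⟨A, hA⟩ : ∃ A : Finset (Fin n) → Finset (Fin n), ∀ I, A I ∈ vertexSets v h₁ ∧
      ∑ i ∈ I, (1 : ℝ) • v i ∈ faceCone v (A I) :=
    ⟨_, fun I => (hs₁.exists_mem_faceCone hv (∑ i ∈ I, (1 : ℝ) • v i)).choose_spec⟩
  -- On the first cone, `g I h` is the support function of `P(h)` at `∑ i ∈ I, v i`, attained at the
  -- vertex of `A I`, minus the bound `∑ i ∈ I, h i`.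
  let g : Finset (Fin n) → Module.Dual ℝ (Fin n → ℝ) := fun I =>
    ∑ k ∈ A I, ⟪dualVec v (A I) k, ∑ i ∈ I, (1 : ℝ) • v i⟫ • LinearMap.proj k -
      ∑ i ∈ I, LinearMap.proj i
  have hg : ∀ I h, g I h =
      ⟪∑ i ∈ I, (1 : ℝ) • v i, vertex v (A I) h⟫ - ∑ i ∈ I, 1 * h i := by
    intro I h
    rw [real_inner_comm, inner_vertex]
    simp [g]
  have hnonpos : ∀ I, ∀ h ∈ weakCone v (vertexSets v h₁), g I h ≤ 0 := by
    intro I h hh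
    rw [hg, sub_nonpos]
    exact inner_le_of_mem_polytopeOf (fun _ _ => zero_le_one) (hh _ (hA I).1)
  have hzero : ∀ I ∈ vertexSets v h₂, ∀ h ∈ weakCone v (vertexSets v h₁),
      (g I h = 0 ↔ vertex v I h ∈ polytopeOf v h) := by
    intro I hI h hh
    have hAh := vertexSets_subset_of_mem_weakCone hh (hA I).1
    rw [hg]
    constructor
    · intro h0
      have h1 : ∑ i ∈ I, (h i - ⟪vertex v (A I) h, v i⟫) = 0 := by
        rw [Finset.sum_sub_distrib, ← inner_sum]
        simp only [one_smul, one_mul] at h0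
        rw [real_inner_comm] at h0
        linarith
      rw [Finset.sum_eq_zero_iff_of_nonneg fun i _ => sub_nonneg.2 (hAh.2 i)] at h1
      rw [← hI.1.eq_vertex fun i hi => (sub_eq_zero.1 (h1 i hi)).symm]
      exact hAh.2
    · intro hmem
      refine le_antisymm (hg I h ▸ hnonpos I h hh) ?_
      rw [sub_nonneg, ← inner_eq_of_tight (v := v) (h := h) (J := I) (fun _ => 1)
        fun i hi => hI.1.inner_vertex_of_mem h hi]
      exact (vertex_mem_maxFace hAh subset_rfl (hA I).2).2 _ hmem
  -- A sum of nonpositive terms vanishes only if each term does, so the zero set of `l` on the first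
  -- cone is the intersection with the second.
  let l : Module.Dual ℝ (Fin n → ℝ) := ∑ I ∈ (vertexSets v h₂).toFinset, g I
  have hl : ∀ h, l h = ∑ I ∈ (vertexSets v h₂).toFinset, g I h := fun h => by simp [l]
  have hl0 : ∀ h ∈ weakCone v (vertexSets v h₁), l h ≤ 0 := fun h hh => by
    rw [hl]
    exact Finset.sum_nonpos fun I _ => hnonpos I h hh
  refine ⟨LinearMap.toContinuousLinearMap l, ?_⟩
  ext h
  simp only [LinearMap.coe_toContinuousLinearMap', Set.mem_ofPred_eq, Set.mem_inter_iff]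
  refine and_congr_right fun hh => ⟨fun hh₂ y hy => ?_, fun hmax I hI => ?_⟩
  · refine (hl0 y hy).trans ?_
    rw [hl]
    exact (Finset.sum_eq_zero fun I hI => (hzero I (by simpa using hI) h hh).2
      (hh₂ I (by simpa using hI))).ge
  -- The origin lies in the cone, so the maximum of `l` is `0`.
  · have h0 : l h = 0 := le_antisymm (hl0 h hh) (by
      simpa using hmax 0 (zero_mem_weakCone v _))
    rw [hl, Finset.sum_eq_zero_iff_of_nonpos fun I _ => hnonpos I h hh] at h0
    exact (hzero I hI h hh).1 (h0 I (by simpa using hI))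

theorem isConicalSubdivision_deformationCones (hv : PositivelySpanning v) :
    IsConicalSubdivision (clir v) (deformationCones v) := by
  refine ⟨finite_deformationCones hv, fun C hC => ?_, sUnion_deformationCones hv,
    fun C hC C' hC' => ?_⟩
  · obtain ⟨h, hh, rfl⟩ := (mem_deformationCones_iff hv).1 hC
    exact ⟨isPolyhedralCone_weakCone _ _, h, interior_maximal
      (strictCone_subset_weakCone fun I hI => hI.1) (isOpen_strictCone _ _) hh.mem_strictCone⟩
  · obtain ⟨h, hh, rfl⟩ := (mem_deformationCones_iff hv).1 hC
    obtain ⟨h', hh', rfl⟩ := (mem_deformationCones_iff hv).1 hC'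
    exact ⟨isExposed_weakCone_inter hv hh, Set.inter_comm _ _ ▸ isExposed_weakCone_inter hv hh'⟩

/-! ### The least-squares objective and its minimizers. -/

theorem exists_quadratic (A : Matrix (Fin m) (Fin n) ℝ) (y : Fin m → ℝ) :
    ∃ q : MvPolynomial (Fin n) ℝ, q.totalDegree ≤ 2 ∧ ∀ h : Fin n → ℝ,
      (1 / (m : ℝ)) * ∑ i, (A.mulVec h i - y i) ^ 2 = MvPolynomial.eval h q := by
  open MvPolynomial in
  have hlin : ∀ i, (∑ k, C (A i k) * X k - C (y i) : MvPolynomial (Fin n) ℝ).totalDegree ≤ 1 := by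
    intro i
    refine (totalDegree_sub _ _).trans (max_le ?_ (by simp))
    refine totalDegree_finsetSum_le fun k _ => (totalDegree_mul _ _).trans ?_
    simp
  open MvPolynomial in
  refine ⟨C (1 / (m : ℝ)) * ∑ i, (∑ k, C (A i k) * X k - C (y i)) ^ 2, ?_, fun h => ?_⟩
  · refine (totalDegree_mul _ _).trans ?_
    rw [totalDegree_C, zero_add]
    refine totalDegree_finsetSum_le fun i _ => (totalDegree_pow _ _).trans ?_
    have := hlin i
    omega
  · simp [Matrix.mulVec, dotProduct]

end Euclidean

end

theorem corollary3p5 {d n m : ℕ} (v : Fin n → EuclideanSpace ℝ (Fin d))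
    (hv : PositivelySpanning v) (u : Fin m → EuclideanSpace ℝ (Fin d)) :
    (∀ y : Fin m → ℝ,
      IsPiecewiseQuadraticOn (lsObjective v u y) (clir v) (deformationCones v)) ∧
    ∃ A : Set (Set (EuclideanSpace ℝ (Fin d))) → Matrix (Fin m) (Fin n) ℝ,
      (∀ Δ ∈ simplicialPolytopalFans v, ∀ h ∈ deformationCone Δ v,
        ∀ i, supportFun (polytopeOf v h) (u i) = (A Δ).mulVec h i) ∧
      ∀ y : Fin m → ℝ,
        (∀ Δ ∈ simplicialPolytopalFans v, ∀ h ∈ deformationCone Δ v,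
          lsObjective v u y h = (1 / (m : ℝ)) * ∑ i, ((A Δ).mulVec h i - y i) ^ 2) ∧
        lsEstimator v u y =
          {h | ∃ Δ ∈ simplicialPolytopalFans v, h ∈ deformationCone Δ v ∧
            ∀ Δ' ∈ simplicialPolytopalFans v, ∀ h' ∈ deformationCone Δ' v,
              (1 / (m : ℝ)) * ∑ i, ((A Δ).mulVec h i - y i) ^ 2 ≤
                (1 / (m : ℝ)) * ∑ i, ((A Δ').mulVec h' i - y i) ^ 2} := by
  have hex : ∀ Δ ∈ simplicialPolytopalFans v, ∃ A : Matrix (Fin m) (Fin n) ℝ,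
      ∀ h ∈ deformationCone Δ v, ∀ i, supportFun (polytopeOf v h) (u i) = A.mulVec h i := by
    intro Δ hΔ
    obtain ⟨h₀, h₀s, rfl⟩ := exists_isSimple_of_mem hv hΔ
    rw [h₀s.deformationCone_eq hv]
    exact h₀s.exists_matrix hv u
  choose! A hA using hex
  have hobj : ∀ y : Fin m → ℝ, ∀ Δ ∈ simplicialPolytopalFans v, ∀ h ∈ deformationCone Δ v,
      lsObjective v u y h = (1 / (m : ℝ)) * ∑ i, ((A Δ).mulVec h i - y i) ^ 2 := by
    intro y Δ hΔ h hh
    simp only [lsObjective, hA Δ hΔ h hh]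
  have hcover : ∀ h, h ∈ clir v ↔ ∃ Δ ∈ simplicialPolytopalFans v, h ∈ deformationCone Δ v := by
    intro h
    rw [← sUnion_deformationCones hv, deformationCones]
    simp
  refine ⟨fun y => ⟨isConicalSubdivision_deformationCones hv, ?_⟩, A, hA, fun y => ⟨hobj y, ?_⟩⟩
  · rintro _ ⟨Δ, hΔ, rfl⟩
    obtain ⟨q, hq, hqe⟩ := exists_quadratic (A Δ) y
    exact ⟨q, hq, fun h hh => (hobj y Δ hΔ h hh).trans (hqe h)⟩
  · ext h
    constructor
    · rintro ⟨hh, hmin⟩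
      obtain ⟨Δ, hΔ, hhΔ⟩ := (hcover h).1 hh
      refine ⟨Δ, hΔ, hhΔ, fun Δ' hΔ' h' hh' => ?_⟩
      rw [← hobj y Δ hΔ h hhΔ, ← hobj y Δ' hΔ' h' hh']
      exact hmin ((hcover h').2 ⟨Δ', hΔ', hh'⟩)
    · rintro ⟨Δ, hΔ, hhΔ, hmin⟩
      refine ⟨(hcover h).2 ⟨Δ, hΔ, hhΔ⟩, fun h' hh' => ?_⟩
      obtain ⟨Δ', hΔ', hh'Δ⟩ := (hcover h').1 hh'
      simp only [Set.mem_ofPred_eq]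
      rw [hobj y Δ hΔ h hhΔ, hobj y Δ' hΔ' h' hh'Δ]
      exact hmin Δ' hΔ' h' hh'Δ
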